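/- Let $\alpha,\beta\in(0,1)$ with $\alpha+\beta<1$, and let $\Lambda=\{\lambda_k\}_{k\ge1}$ be a sequence of positive numbers such that $$\frac{\lambda_k}{k^{1-(\alpha+\beta)}}\downarrow 0,\qquad \sum_{k=1}^\infty\frac{\lambda_k}{k^{2-(\alpha+\beta)}}<\infty .$$ Let $f:\mathbb R^2\to\mathbb R$ be $2\pi$-periodic in each variable, integrable on $[0,2\pi]^2$, and of bounded partial $\Lambda$-variation, i.e. $$\sup_{y}\sup_{\{(a_i,b_i)\}}\sum_i\frac{|f(b_i,y)-f(a_i,y)|}{\lambda_i}+\sup_{x}\sup_{\{(a_j,b_j)\}}\sum_j\frac{|f(x,b_j)-f(x,a_j)|}{\lambda_j}<\infty ,$$ where $x,y$ range over $[0,2\pi]$ and the inner suprema are over all finite families of nonoverlapping intervals in $[0,2\pi]$, indexed by $1,2,\dots,N$ in an arbitrary order. Let $$\widehat f(k,l)=\frac1{4\pi^2}\int_0^{2\pi}\!\!\int_0^{2\pi}f(x,y)e^{-ikx}e^{-ily}\,dx\,dy,\qquad S_{p,q}(x,y)=\sum_{k=-p}^{p}\sum_{l=-q}^{q}\widehat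 f(k,l)e^{ikx}e^{ily},$$ let $A_0^\gamma=1$, $A_k^\gamma=(\gamma+1)\cdots(\gamma+k)/k!$ for $k\ge1$, and let $$\sigma_{n,m}(x,y)=\frac1{A_n^{-\alpha}A_m^{-\beta}}\sum_{p=0}^n\sum_{q=0}^m A_{n-p}^{-\alpha-1}A_{m-q}^{-\beta-1}S_{p,q}(x,y)$$ be the Cesàro $(C;-\alpha,-\beta)$ means of the double Fourier series of $f$. Then: 1. at every point $(x,y)$ at which the four limits $f(x\pm0,y\pm0)$ of $f$ over the open coordinate quadrants with vertex $(x,y)$ exist, $$\lim_{n,m\to\infty}\sigma_{n,m}(x,y)=\tfrac14\bigl(f(x+0,y+0)+f(x+0,y-0)+f(x-0,y+0)+f(x-0,y-0)\bigr),$$ where $n$ and $m$ tend to infinity independently; 2. for every compact $K\subset\mathbb R^2$ such that $f$ is continuous (as a function on $\mathbb R^2$) at every point of $K$, $\sigma_{n,m}\to f$ uniformly on $K$ as $n,m\to\infty$. -/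

import Mathlib

open Set Filter Topology MeasureTheory
open scoped ENNReal

noncomputable section

namespace PartialVariation

/-- The square `[0, 2π]²`. -/
def square : Set (ℝ × ℝ) := Icc 0 (2 * Real.pi) ×ˢ Icc 0 (2 * Real.pi)

/-- `f` has period `2π` with respect to each variable. -/
def Periodic2 (f : ℝ × ℝ → ℝ) : Prop :=
  (∀ x y, f (x + 2 * Real.pi, y) = f (x, y)) ∧ (∀ x y, f (x, y + 2 * Real.pi) = f (x, y))

/-- `(a i, b i)`, `i < N`, are nonoverlapping intervals in `[0, 2π]`; the family is indexed,
so it is ordered in an arbitrary way. -/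
def Nonoverlapping {N : ℕ} (a b : Fin N → ℝ) : Prop :=
  (∀ i, 0 ≤ a i ∧ a i < b i ∧ b i ≤ 2 * Real.pi) ∧
    Pairwise fun i j => Disjoint (Ioo (a i) (b i)) (Ioo (a j) (b j))

/-- The `Λ`-variation on `[0, 2π]` of a function of one variable, for the sequence
`lam 1, lam 2, …` (the term `lam 0` is not used). -/
def lambdaVar (lam : ℕ → ℝ) (g : ℝ → ℝ) : ℝ≥0∞ :=
  ⨆ (N : ℕ) (a : Fin N → ℝ) (b : Fin N → ℝ) (_ : Nonoverlapping a b),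
    ∑ i : Fin N, ENNReal.ofReal (|g (b i) - g (a i)| / lam ((i : ℕ) + 1))

/-- The partial `Λ`-variation in the first variable. -/
def lambdaVar₁ (lam : ℕ → ℝ) (f : ℝ × ℝ → ℝ) : ℝ≥0∞ :=
  ⨆ y ∈ Icc 0 (2 * Real.pi), lambdaVar lam fun x => f (x, y)

/-- The partial `Λ`-variation in the second variable. -/
def lambdaVar₂ (lam : ℕ → ℝ) (f : ℝ × ℝ → ℝ) : ℝ≥0∞ :=
  ⨆ x ∈ Icc 0 (2 * Real.pi), lambdaVar lam fun y => f (x, y)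

/-- `f` has bounded partial `Λ`-variation. -/
def BoundedPartialVar (lam : ℕ → ℝ) (f : ℝ × ℝ → ℝ) : Prop :=
  lambdaVar₁ lam f + lambdaVar₂ lam f < ∞

/-- The double trigonometric Fourier coefficients. -/
def coeff (f : ℝ × ℝ → ℝ) (m n : ℤ) : ℂ :=
  1 / (4 * (Real.pi : ℂ) ^ 2) *
    ∫ p in square, (f p : ℂ) * Complex.exp (-(Complex.I * m * p.1)) *
      Complex.exp (-(Complex.I * n * p.2))

/-- The rectangular partial sums of the double Fourier series. -/
def partialSum (f : ℝ × ℝ → ℝ) (M N : ℕ) (p : ℝ × ℝ) : ℂ :=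
  ∑ m ∈ Finset.Icc (-(M : ℤ)) M, ∑ n ∈ Finset.Icc (-(N : ℤ)) N,
    coeff f m n * Complex.exp (Complex.I * m * p.1) * Complex.exp (Complex.I * n * p.2)

/-- The Cesàro numbers `(γ + 1) ⋯ (γ + k) / k!`. -/
def cesaroNumber (γ : ℝ) (k : ℕ) : ℝ :=
  (∏ i ∈ Finset.Icc 1 k, (γ + i)) / (k.factorial : ℝ)

/-- The Cesàro `(C; γ, δ)` means of the double Fourier series. -/
def cesaroMean (γ δ : ℝ) (f : ℝ × ℝ → ℝ) (n m : ℕ) (p : ℝ × ℝ) : ℂ :=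
  1 / (cesaroNumber γ n : ℂ) * (1 / (cesaroNumber δ m : ℂ)) *
    ∑ i ∈ Finset.range (n + 1), ∑ j ∈ Finset.range (m + 1),
      (cesaroNumber (γ - 1) (n - i) : ℂ) * (cesaroNumber (δ - 1) (m - j) : ℂ) *
        partialSum f i j p

/-- The double Fourier series of `f` is `(C; γ, δ)` summable to `s` at `p`: the means converge
as `n` and `m` tend to infinity independently. -/
def CesaroSummable (γ δ : ℝ) (f : ℝ × ℝ → ℝ) (p : ℝ × ℝ) (s : ℝ) : Prop :=
  Tendsto (fun k : ℕ × ℕ => cesaroMean γ δ f k.1 k.2 p) (atTop ×ˢ atTop) (𝓝 (s : ℂ))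

/-- Uniform `(C; γ, δ)` summability to `f` on `K`. -/
def CesaroSummableUniformlyOn (γ δ : ℝ) (f : ℝ × ℝ → ℝ) (K : Set (ℝ × ℝ)) : Prop :=
  TendstoUniformlyOn (fun (k : ℕ × ℕ) p => cesaroMean γ δ f k.1 k.2 p)
    (fun p => (f p : ℂ)) (atTop ×ˢ atTop) K

end PartialVariation

end

namespace PartialVariation

section

/-! ### Power sums -/

/-! The Cesàro mean is the convolution of `f` with a product of two kernels (`cesaroMean_eq`). Each
kernel is even with integral `π` over `(0, π]`. So its deviation from the average of four numbers
`L` is a sum of four integrals of `(f(x ± s, y ± t) - L) K_n(s) K_m(t)` over `(0, π]²`, divided by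
`4π²` (`cesaroMean_sub_eq`). The size bound `n^a s^(a-1)` for a kernel of order `-a` integrates to
order `n^a`, so absolute values are too crude and cancellation is needed.

The cancellation comes from a factor `z^n`, `z = exp(is)`: the kernel is `z^n` times a slowly
varying quotient, plus the conjugate, so it nearly changes sign under translation by `π/n`. Cut `(0,
π]` into cells of that length. At a fixed offset `u`, the values at `u + kπ/n` are `O(n
(k+1)^(a-1))`, sums of two neighbours are `O(n (k+1)^(a-2))`, and hence tails over `i ≥ k` are again
`O(n (k+1)^(a-1))` (`exists_norm_sum_cesaroKernel_le`). Abel summation in both indices reduces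
everything to the sum of `|ΔF(k,l)| (k+1)^(α-1) (l+1)^(β-1)`, where `F` holds the values of `f - L`
on the grid and `Δ` is the mixed difference.

Only partial variations are controlled, so for `k ≥ l` the mixed difference is treated as two
differences in `k`, and symmetrically for `l ≥ k`. Since the variation bound holds for every
ordering, the rearrangement inequality bounds the weighted sum over `k ≥ p` by `V W(p) (p+1)^(α-1)`,
with `W = weightSum lam` (`sum_Ico_mul_rpow_le`). Summing over `l` leaves tails of `∑ W(j)
(j+1)^(α+β-2)`, a series that converges by interchanging sums and using the summability hypothesis.
Thus some `P` depending on `ε`, but not on `n`, `m` or the point, makes everything outside the block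
`k, l < P` small (`exists_sum_abs_mixedDiff_le`). Inside the block `F` itself is small, because
those grid points approach the vertex as `n, m → ∞`. The resulting estimate,
`exists_norm_cesaroMean_sub_le`, is uniform in the point and yields both assertions. -/

lemma one_sub_rpow_le {p x : ℝ} (hp : 0 ≤ p) (hp1 : p ≤ 1) (hx1 : x ≤ 1) :
    (1 - x) ^ p ≤ 1 - p * x := by
  have := rpow_one_add_le_one_add_mul_self (s := -x) (p := p) (by linarith) hp hp1
  simpa [sub_eq_add_neg] using this

lemma rpow_le_rpow_mul {p y : ℝ} (hp : 0 ≤ p) (hp1 : p ≤ 1) (hy : 0 ≤ y) :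
    y ^ p ≤ (y + 1) ^ p * (1 - p / (y + 1)) := by
  have hy1 : 0 < y + 1 := by linarith
  have h := one_sub_rpow_le hp hp1 (x := 1 / (y + 1))
    ((div_le_one hy1).2 (by linarith))
  have e : y = (y + 1) * (1 - 1 / (y + 1)) := by field_simp; ring
  calc y ^ p = ((y + 1) * (1 - 1 / (y + 1))) ^ p := by rw [← e]
    _ = (y + 1) ^ p * (1 - 1 / (y + 1)) ^ p := by
        rw [Real.mul_rpow hy1.le]
        rw [sub_nonneg, div_le_one hy1]; linarith
    _ ≤ _ := by
        refine mul_le_mul_of_nonneg_left (h.trans (le_of_eq ?_)) (by positivity)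
        ring

lemma mul_rpow_sub_one_le {p y : ℝ} (hp : 0 ≤ p) (hp1 : p ≤ 1) (hy : 0 ≤ y) :
    p * (y + 1) ^ (p - 1) ≤ (y + 1) ^ p - y ^ p := by
  have hy1 : 0 < y + 1 := by linarith
  have h := rpow_le_rpow_mul hp hp1 hy
  rw [Real.rpow_sub_one hy1.ne']
  have : (y + 1) ^ p * (1 - p / (y + 1)) = (y + 1) ^ p - p * ((y + 1) ^ p / (y + 1)) := by
    field_simp
  linarith

lemma sum_range_rpow_sub_one_le {p : ℝ} (hp : 0 < p) (hp1 : p ≤ 1) (N : ℕ) :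
    ∑ j ∈ Finset.range N, ((j : ℝ) + 1) ^ (p - 1) ≤ (N : ℝ) ^ p / p := by
  induction N with
  | zero => simp [Real.zero_rpow hp.ne']
  | succ N ih =>
    rw [Finset.sum_range_succ]
    have h := mul_rpow_sub_one_le hp.le hp1 (Nat.cast_nonneg (α := ℝ) N)
    rw [le_div_iff₀ hp] at ih ⊢
    push_cast
    nlinarith

/-- Bernoulli's inequality for the exponent `1 - p`, inverted by means of `(1 + x)(1 - x) ≤ 1`. -/
lemma mul_rpow_sub_two_le {p y : ℝ} (hp : 0 ≤ p) (hp1 : p ≤ 1) (hy : 0 < y) :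
    (1 - p) * (y + 1) ^ (p - 2) ≤ y ^ (p - 1) - (y + 1) ^ (p - 1) := by
  have hy1 : 0 < y + 1 := by linarith
  have h := rpow_le_rpow_mul (p := 1 - p) (by linarith) (by linarith) hy.le
  have e1 : y ^ (p - 1) = (y ^ (1 - p))⁻¹ := by rw [← Real.rpow_neg hy.le]; congr 1; ring
  have e2 : (y + 1) ^ (p - 1) = ((y + 1) ^ (1 - p))⁻¹ := by
    rw [← Real.rpow_neg hy1.le]; congr 1; ring
  have e3 : (y + 1) ^ (p - 2) = ((y + 1) ^ (1 - p))⁻¹ / (y + 1) := by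
    rw [← e2, ← Real.rpow_sub_one hy1.ne']; congr 1; ring
  have hX : 0 < (y + 1) ^ (1 - p) := by positivity
  have hY : 0 < y ^ (1 - p) := by positivity
  rw [e1, e2, e3]
  set X := (y + 1) ^ (1 - p)
  set Y := y ^ (1 - p)
  have hq : 0 < 1 - (1 - p) / (y + 1) := by
    have := (mul_pos_iff_of_pos_left hX).1 (hY.trans_le h)
    exact this
  have h1 : X⁻¹ * (1 + (1 - p) / (y + 1)) ≤ Y⁻¹ := by
    rw [le_inv_comm₀ (by positivity) hY]
    refine h.trans ?_
    rw [mul_inv, inv_inv]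
    refine mul_le_mul_of_nonneg_left ?_ hX.le
    have : 0 ≤ (1 - p) / (y + 1) := by apply div_nonneg <;> linarith
    rw [le_inv_comm₀ hq (by linarith)]
    rw [← one_div, le_div_iff₀ hq]
    nlinarith [sq_nonneg ((1 - p) / (y + 1))]
  have : X⁻¹ * (1 + (1 - p) / (y + 1)) = X⁻¹ + (1 - p) * (X⁻¹ / (y + 1)) := by field_simp
  linarith

/-- Telescoping of the preceding inequality. The factor 4 pays for replacing `i + 1` by `i + 2`, at
most twice as large, under an exponent that is at least `-2`. -/
lemma sum_Ico_rpow_sub_two_le {p : ℝ} (hp : 0 ≤ p) (hp1 : p < 1) (k N : ℕ) :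
    ∑ i ∈ Finset.Ico k N, ((i : ℝ) + 1) ^ (p - 2) ≤ 4 / (1 - p) * ((k : ℝ) + 1) ^ (p - 1) := by
  have hq : 0 < 1 - p := by linarith
  have key : ∀ i : ℕ, ((i : ℝ) + 1) ^ (p - 2) ≤
      4 / (1 - p) * (((i : ℝ) + 1) ^ (p - 1) - (((i + 1 : ℕ) : ℝ) + 1) ^ (p - 1)) := by
    intro i
    have h := mul_rpow_sub_two_le hp hp1.le (y := (i : ℝ) + 1) (by positivity)
    have h2 : ((i : ℝ) + 1) ^ (p - 2) ≤ 4 * ((i : ℝ) + 1 + 1) ^ (p - 2) := by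
      have h3 : (2 * ((i : ℝ) + 1)) ^ (p - 2) ≤ ((i : ℝ) + 1 + 1) ^ (p - 2) := by
        apply Real.rpow_le_rpow_of_nonpos (by positivity) _ (by linarith)
        have : (0 : ℝ) ≤ i := by positivity
        linarith
      rw [Real.mul_rpow (by norm_num) (by positivity)] at h3
      have h4 : (1 / 4 : ℝ) ≤ 2 ^ (p - 2) := by
        have : (2 : ℝ) ^ (-2 : ℝ) ≤ 2 ^ (p - 2) :=
          Real.rpow_le_rpow_of_exponent_le (by norm_num) (by linarith)
        refine le_trans (le_of_eq ?_) this
        rw [Real.rpow_neg (by norm_num)]; norm_num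
      have h5 : 0 ≤ ((i : ℝ) + 1) ^ (p - 2) := by positivity
      nlinarith
    push_cast
    rw [div_mul_eq_mul_div, le_div_iff₀ hq]
    nlinarith
  rcases le_total N k with h | h
  · rw [Finset.Ico_eq_empty_of_le h]; simp; positivity
  · calc _ ≤ ∑ i ∈ Finset.Ico k N,
          4 / (1 - p) * (((i : ℝ) + 1) ^ (p - 1) - (((i + 1 : ℕ) : ℝ) + 1) ^ (p - 1)) :=
          Finset.sum_le_sum fun i _ => key i
      _ = 4 / (1 - p) * (((k : ℝ) + 1) ^ (p - 1) - ((N : ℝ) + 1) ^ (p - 1)) := by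
          rw [← Finset.mul_sum]
          congr 1
          have := Finset.sum_Ico_sub (fun i : ℕ => -((i : ℝ) + 1) ^ (p - 1)) h
          simp only [neg_sub_neg] at this
          rw [this]
      _ ≤ _ := by
          refine mul_le_mul_of_nonneg_left ?_ (by positivity)
          have : 0 ≤ ((N : ℝ) + 1) ^ (p - 1) := by positivity
          linarith

/-! ### Cesàro numbers -/

lemma cesaroNumber_zero (γ : ℝ) : cesaroNumber γ 0 = 1 := by simp [cesaroNumber]

lemma cesaroNumber_succ (γ : ℝ) (k : ℕ) :
    cesaroNumber γ (k + 1) = cesaroNumber γ k * ((γ + (k + 1)) / (k + 1)) := by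
  unfold cesaroNumber
  rw [Finset.prod_Icc_succ_top (by omega), Nat.factorial_succ]
  push_cast
  have : (k.factorial : ℝ) ≠ 0 := by positivity
  field_simp

lemma cesaroNumber_sub_one_succ (γ : ℝ) (k : ℕ) :
    cesaroNumber (γ - 1) (k + 1) = cesaroNumber γ k * (γ / (k + 1)) := by
  induction k with
  | zero => rw [cesaroNumber_succ]; simp [cesaroNumber_zero]
  | succ k ih =>
    rw [cesaroNumber_succ, ih, cesaroNumber_succ]
    push_cast
    field_simp
    ring

lemma cesaroNumber_succ_sub (γ : ℝ) (k : ℕ) :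
    cesaroNumber γ (k + 1) - cesaroNumber γ k = cesaroNumber (γ - 1) (k + 1) := by
  rw [cesaroNumber_sub_one_succ, cesaroNumber_succ]
  field_simp
  ring

lemma sum_cesaroNumber_sub_one (γ : ℝ) (n : ℕ) :
    ∑ i ∈ Finset.range (n + 1), cesaroNumber (γ - 1) i = cesaroNumber γ n := by
  induction n with
  | zero => simp [cesaroNumber_zero]
  | succ n ih => rw [Finset.sum_range_succ, ih, ← cesaroNumber_succ_sub]; ring

variable {a : ℝ}

lemma cesaroNumber_neg_pos (ha : a ∈ Ioo (0 : ℝ) 1) (k : ℕ) : 0 < cesaroNumber (-a) k := by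
  induction k with
  | zero => simp [cesaroNumber_zero]
  | succ k ih =>
    rw [cesaroNumber_succ]
    have : (0 : ℝ) ≤ k := by positivity
    have : 0 < -a + ((k : ℝ) + 1) := by linarith [ha.2]
    positivity

lemma cesaroNumber_neg_antitone (ha : a ∈ Ioo (0 : ℝ) 1) : Antitone (cesaroNumber (-a)) := by
  refine antitone_nat_of_succ_le fun k => ?_
  rw [cesaroNumber_succ]
  refine mul_le_of_le_one_right (cesaroNumber_neg_pos ha k).le ?_
  rw [div_le_one (by positivity)]
  linarith [ha.1]

/-- Induction on the ratio of consecutive terms, `1 - a/(k+1)`, which is at most `((k+1)/(k+2))^a`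
by Bernoulli. -/
lemma cesaroNumber_neg_le (ha : a ∈ Ioo (0 : ℝ) 1) (k : ℕ) :
    cesaroNumber (-a) k ≤ ((k : ℝ) + 1) ^ (-a) := by
  induction k with
  | zero => simp [cesaroNumber_zero]
  | succ k ih =>
    rw [cesaroNumber_succ]
    have hk : (0 : ℝ) ≤ k := by positivity
    have h1 : ((k : ℝ) + 1 + 1) ^ a * (1 - a / ((k : ℝ) + 1)) ≤ ((k : ℝ) + 1) ^ a := by
      have h3 : (1 + 1 / ((k : ℝ) + 1)) ^ a ≤ 1 + a * (1 / ((k : ℝ) + 1)) :=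
        rpow_one_add_le_one_add_mul_self (by linarith [show 0 ≤ 1 / ((k : ℝ) + 1) by positivity])
          ha.1.le ha.2.le
      have e : (k : ℝ) + 1 + 1 = (k + 1) * (1 + 1 / ((k : ℝ) + 1)) := by field_simp
      rw [e, Real.mul_rpow (by positivity) (by positivity), mul_assoc]
      refine mul_le_of_le_one_right (by positivity) ?_
      have h4 : 0 ≤ 1 - a / ((k : ℝ) + 1) := by
        rw [sub_nonneg, div_le_one (by positivity)]; linarith [ha.2]
      calc _ ≤ (1 + a * (1 / ((k : ℝ) + 1))) * (1 - a / ((k : ℝ) + 1)) :=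
            mul_le_mul_of_nonneg_right h3 h4
        _ = 1 - (a / ((k : ℝ) + 1)) ^ 2 := by ring
        _ ≤ 1 := by linarith [sq_nonneg (a / ((k : ℝ) + 1))]
    have h2 : (-a + ((k : ℝ) + 1)) / (k + 1) = 1 - a / (k + 1) := by field_simp; ring
    have h4 : 0 ≤ 1 - a / ((k : ℝ) + 1) := by
      rw [sub_nonneg, div_le_one (by positivity)]; linarith [ha.2]
    rw [h2]
    push_cast
    calc _ ≤ ((k : ℝ) + 1) ^ (-a) * (1 - a / (k + 1)) := mul_le_mul_of_nonneg_right ih h4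
      _ ≤ _ := by
        rw [Real.rpow_neg (by positivity), Real.rpow_neg (by positivity), ← div_eq_inv_mul,
          div_le_iff₀ (by positivity), ← div_eq_inv_mul, le_div_iff₀ (by positivity)]
        linarith

/-- The ratio `1 - a/(k+1)` is also at least `(k/(k+1))^a`; the constant `1 - a` is the value at `k
= 1`. -/
lemma le_cesaroNumber_neg (ha : a ∈ Ioo (0 : ℝ) 1) {k : ℕ} (hk : 1 ≤ k) :
    (1 - a) * (k : ℝ) ^ (-a) ≤ cesaroNumber (-a) k := by
  induction k, hk using Nat.le_induction with
  | base => rw [cesaroNumber_succ]; simp [cesaroNumber_zero]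
  | succ k hk ih =>
    rw [cesaroNumber_succ]
    have hk0 : (0 : ℝ) < k := by exact_mod_cast hk
    have h := rpow_le_rpow_mul ha.1.le ha.2.le hk0.le
    have h2 : (-a + ((k : ℝ) + 1)) / (k + 1) = 1 - a / (k + 1) := by field_simp; ring
    have h4 : 0 ≤ 1 - a / ((k : ℝ) + 1) := by
      rw [sub_nonneg, div_le_one (by positivity)]; linarith [ha.2]
    rw [h2]
    push_cast
    refine le_trans ?_ (mul_le_mul_of_nonneg_right ih h4)
    rw [mul_assoc]
    refine mul_le_mul_of_nonneg_left ?_ (by linarith [ha.2])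
    rw [Real.rpow_neg (by positivity), Real.rpow_neg (by positivity), ← div_eq_inv_mul,
      le_div_iff₀ (by positivity), ← div_eq_inv_mul, div_le_iff₀ (by positivity)]
    linarith

lemma inv_cesaroNumber_neg_le (ha : a ∈ Ioo (0 : ℝ) 1) {n : ℕ} (hn : 1 ≤ n) :
    (cesaroNumber (-a) n)⁻¹ ≤ (1 - a)⁻¹ * (n : ℝ) ^ a := by
  have hn0 : (0 : ℝ) < n := by exact_mod_cast hn
  have h1 : 0 < 1 - a := by linarith [ha.2]
  have := inv_anti₀ (by positivity) (le_cesaroNumber_neg ha hn)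
  rwa [mul_inv, Real.rpow_neg hn0.le, inv_inv] at this

lemma sum_cesaroNumber_neg_le (ha : a ∈ Ioo (0 : ℝ) 1) (n : ℕ) :
    ∑ j ∈ Finset.range n, cesaroNumber (-a) j ≤ (1 - a)⁻¹ * (n : ℝ) ^ (1 - a) := by
  refine (Finset.sum_le_sum fun j _ => cesaroNumber_neg_le ha j).trans ?_
  have := sum_range_rpow_sub_one_le (p := 1 - a) (by linarith [ha.2]) (by linarith [ha.1]) n
  rw [show 1 - a - 1 = -a by ring] at this
  rwa [← div_eq_inv_mul]

end

section

/-! ### The Cesàro kernel -/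

/-- The polynomial with the Cesàro numbers of order `γ` as coefficients. -/
noncomputable def cesaroPoly (γ : ℝ) (n : ℕ) (z : ℂ) : ℂ :=
  ∑ j ∈ Finset.range (n + 1), (cesaroNumber γ j : ℂ) * z ^ j

/-- The kernel of the Cesàro means of order `-a` (twice the real kernel in the usual
normalization). -/
noncomputable def cesaroKernel (a : ℝ) (n : ℕ) (s : ℝ) : ℂ :=
  1 / (cesaroNumber (-a) n : ℂ) * ∑ i ∈ Finset.range (n + 1), (cesaroNumber (-a - 1) (n - i) : ℂ) *
    ∑ k ∈ Finset.Icc (-(i : ℤ)) i, Complex.exp (Complex.I * k * s)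

/-- Consecutive Cesàro numbers of order `γ` differ by one of order `γ - 1`. Multiplication by `1 -
z` thus lowers the order, at the price of one boundary term. -/
lemma one_sub_mul_cesaroPoly (γ : ℝ) (n : ℕ) (z : ℂ) :
    (1 - z) * cesaroPoly γ n z =
      cesaroPoly (γ - 1) n z - (cesaroNumber γ n : ℂ) * z ^ (n + 1) := by
  unfold cesaroPoly
  induction n with
  | zero => simp [cesaroNumber_zero]
  | succ n ih =>
    rw [Finset.sum_range_succ, mul_add, ih, Finset.sum_range_succ _ (n + 1),
      ← cesaroNumber_succ_sub]
    push_cast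
    ring

/-- Differentiation in the angle raises the order, by `cesaroNumber_sub_one_succ`. Bounds for order
`-a` thereby control increments of the polynomials of order `-a - 1` that occur in the kernel. -/
lemma hasDerivAt_cesaroPoly_exp (γ : ℝ) (n : ℕ) (s : ℝ) :
    HasDerivAt (fun s : ℝ => cesaroPoly (γ - 1) (n + 1) (Complex.exp (Complex.I * s)))
      (γ * Complex.I * Complex.exp (Complex.I * s) *
        cesaroPoly γ n (Complex.exp (Complex.I * s))) s := by
  have hexp : HasDerivAt (fun s : ℝ => Complex.exp (Complex.I * s))
      (Complex.exp (Complex.I * s) * Complex.I) s := by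
    have h : HasDerivAt (fun s : ℝ => Complex.I * (s : ℂ)) Complex.I s := by
      simpa using (Complex.ofRealCLM.hasDerivAt (x := s)).const_mul Complex.I
    exact h.cexp
  unfold cesaroPoly
  simp only [Finset.sum_range_succ' _ (n + 1)]
  have h := HasDerivAt.fun_sum (u := Finset.range (n + 1)) (fun j _ =>
    (hexp.fun_pow (j + 1)).const_mul ((cesaroNumber (γ - 1) (j + 1) : ℝ) : ℂ))
  simp only [pow_zero]
  refine (h.add_const _).congr_deriv ?_
  rw [Finset.mul_sum]
  refine Finset.sum_congr rfl fun j _ => ?_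
  rw [cesaroNumber_sub_one_succ]
  push_cast
  have : (j : ℂ) + 1 ≠ 0 := by exact_mod_cast Nat.succ_ne_zero j
  field_simp

lemma sub_one_mul_sum_exp (i : ℕ) (s : ℝ) :
    (Complex.exp (Complex.I * s) - 1) *
        ∑ k ∈ Finset.Icc (-(i : ℤ)) i, Complex.exp (Complex.I * k * s) =
      Complex.exp (Complex.I * s) ^ (i + 1) - (Complex.exp (Complex.I * s))⁻¹ ^ i := by
  have hz : Complex.exp (Complex.I * s) ≠ 0 := Complex.exp_ne_zero _
  have e : ∀ k : ℤ, Complex.exp (Complex.I * k * s) = Complex.exp (Complex.I * s) ^ k := by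
    intro k; rw [← Complex.exp_int_mul]; ring_nf
  simp only [e]
  set z := Complex.exp (Complex.I * s)
  induction i with
  | zero => simp
  | succ i ih =>
    have hset : Finset.Icc (-((i + 1 : ℕ) : ℤ)) ((i + 1 : ℕ) : ℤ) =
        insert (-((i + 1 : ℕ) : ℤ)) (insert ((i + 1 : ℕ) : ℤ) (Finset.Icc (-(i : ℤ)) i)) := by
      ext x; simp only [Finset.mem_Icc, Finset.mem_insert]; omega
    rw [hset, Finset.sum_insert, Finset.sum_insert, mul_add, mul_add, ih]
    · rw [zpow_neg, zpow_natCast, inv_pow, inv_pow]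
      field_simp
      ring
    · simp only [Finset.mem_Icc]; omega
    · simp only [Finset.mem_insert, Finset.mem_Icc]; omega

/-- The quotient in terms of which the Cesàro kernel is written. -/
noncomputable def kernelQuotient (a : ℝ) (n : ℕ) (s : ℝ) : ℂ :=
  cesaroPoly (-a - 1) n (Complex.exp (Complex.I * s)) / (1 - Complex.exp (Complex.I * s))

lemma exp_neg_I_mul (s : ℝ) :
    Complex.exp (Complex.I * ((-s : ℝ) : ℂ)) = (Complex.exp (Complex.I * s))⁻¹ := by
  rw [← Complex.exp_neg]; push_cast; ring_nf

lemma kernelQuotient_neg (a : ℝ) (n : ℕ) (s : ℝ) :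
    kernelQuotient a n (-s) = (starRingEnd ℂ) (kernelQuotient a n s) := by
  have e : (starRingEnd ℂ) (Complex.exp (Complex.I * s)) =
      Complex.exp (Complex.I * ((-s : ℝ) : ℂ)) := by
    rw [← Complex.exp_conj]; simp
  unfold kernelQuotient cesaroPoly
  simp only [map_div₀, map_sum, map_sub, map_mul, map_pow, e, Complex.conj_ofReal, map_one]

/-- Insert the closed form of the Dirichlet kernel and reverse the summation. All rapid oscillation
is now in `z^n` and its inverse. -/
lemma cesaroKernel_eq (a : ℝ) (n : ℕ) (s : ℝ) (hz : Complex.exp (Complex.I * s) ≠ 1) :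
    cesaroKernel a n s = 1 / (cesaroNumber (-a) n : ℂ) *
      (Complex.exp (Complex.I * s) ^ n * kernelQuotient a n (-s) +
        (Complex.exp (Complex.I * s))⁻¹ ^ n * kernelQuotient a n s) := by
  unfold cesaroKernel kernelQuotient cesaroPoly
  rw [exp_neg_I_mul]
  congr 1
  have hD : ∀ i : ℕ, ∑ k ∈ Finset.Icc (-(i : ℤ)) i, Complex.exp (Complex.I * k * s) =
      (Complex.exp (Complex.I * s) ^ (i + 1) - (Complex.exp (Complex.I * s))⁻¹ ^ i) /
        (Complex.exp (Complex.I * s) - 1) := fun i => by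
    rw [eq_div_iff (sub_ne_zero.2 hz), mul_comm, sub_one_mul_sum_exp]
  simp only [hD]
  have hz0 : Complex.exp (Complex.I * s) ≠ 0 := Complex.exp_ne_zero _
  set z := Complex.exp (Complex.I * s)
  have h1 : z - 1 ≠ 0 := sub_ne_zero.2 hz
  have h2 : 1 - z ≠ 0 := sub_ne_zero.2 hz.symm
  have h3 : 1 - z⁻¹ ≠ 0 := by rw [sub_ne_zero]; exact fun h => hz (by rw [← inv_inv z, ← h, inv_one])
  rw [Finset.sum_div, Finset.sum_div, Finset.mul_sum, Finset.mul_sum, ← Finset.sum_add_distrib,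
    ← Finset.sum_range_reflect]
  refine Finset.sum_congr rfl fun j hj => ?_
  have hj' : j ≤ n := by simpa [Nat.lt_succ_iff] using hj
  rw [show n + 1 - 1 - j = n - j by omega, show n - (n - j) = j by omega]
  obtain ⟨d, rfl⟩ := Nat.exists_eq_add_of_le hj'
  rw [show j + d - j = d by omega]
  have e1 : z / (z - 1) = 1 / (1 - z⁻¹) := by field_simp
  have e2 : 1 / (1 - z) = - (1 / (z - 1)) := by rw [← neg_sub, one_div, one_div, inv_neg]
  have hp : z ^ j * z⁻¹ ^ j = 1 := by rw [← mul_pow, mul_inv_cancel₀ hz0, one_pow]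
  have e3 : z ^ (j + d) * ((cesaroNumber (-a - 1) j : ℂ) * z⁻¹ ^ j / (1 - z⁻¹)) =
      (cesaroNumber (-a - 1) j : ℂ) * z ^ d * (1 / (1 - z⁻¹)) := by
    rw [pow_add]
    linear_combination ((cesaroNumber (-a - 1) j : ℂ) * z ^ d * (1 / (1 - z⁻¹))) * hp
  have e4 : z⁻¹ ^ (j + d) * ((cesaroNumber (-a - 1) j : ℂ) * z ^ j / (1 - z)) =
      (cesaroNumber (-a - 1) j : ℂ) * z⁻¹ ^ d * (1 / (1 - z)) := by
    rw [pow_add]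
    linear_combination ((cesaroNumber (-a - 1) j : ℂ) * z⁻¹ ^ d * (1 / (1 - z))) * hp
  rw [e3, e4, ← e1, e2, pow_succ]
  ring

/-! ### Size and regularity of the kernel -/

lemma norm_exp_I_mul (s : ℝ) : ‖Complex.exp (Complex.I * s)‖ = 1 := by
  rw [mul_comm]; exact Complex.norm_exp_ofReal_mul_I s

lemma le_norm_one_sub_exp {s : ℝ} (hs : 0 ≤ s) (hs' : s ≤ Real.pi) :
    2 / Real.pi * s ≤ ‖1 - Complex.exp (Complex.I * s)‖ := by
  rw [norm_sub_rev, Complex.norm_exp_I_mul_ofReal_sub_one, Real.norm_eq_abs]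
  have := Real.mul_le_sin (x := s / 2) (by linarith) (by linarith)
  refine le_trans ?_ (le_abs_self _)
  linarith

lemma norm_exp_sub_exp_le (s t : ℝ) :
    ‖Complex.exp (Complex.I * t) - Complex.exp (Complex.I * s)‖ ≤ |t - s| := by
  have e : Complex.exp (Complex.I * t) - Complex.exp (Complex.I * s) =
      Complex.exp (Complex.I * s) * (Complex.exp (Complex.I * ((t - s : ℝ) : ℂ)) - 1) := by
    rw [mul_sub, ← Complex.exp_add]; push_cast; ring_nf
  rw [e, norm_mul, norm_exp_I_mul, one_mul]
  simpa using Real.norm_exp_I_mul_ofReal_sub_one_le (x := t - s)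

/-- Abel's inequality for a power series with decreasing coefficients. -/
lemma norm_one_sub_mul_sum_Ico_le {B : ℕ → ℝ} (hB : Antitone B) (hB0 : ∀ j, 0 ≤ B j) {z : ℂ}
    (hz : ‖z‖ = 1) {p N : ℕ} (h : p ≤ N) :
    ‖(1 - z) * ∑ j ∈ Finset.Ico p N, (B j : ℂ) * z ^ j‖ ≤ 2 * B p := by
  -- The boundary term `B N * z ^ N` is kept on the left so that the induction closes.
  have key : ‖(1 - z) * ∑ j ∈ Finset.Ico p N, (B j : ℂ) * z ^ j + B N * z ^ N‖ ≤ 2 * B p - B N := by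
    induction N, h using Nat.le_induction with
    | base =>
      simp [hz, abs_of_nonneg (hB0 p)]
      linarith
    | succ N hN ih =>
      rw [Finset.sum_Ico_succ_top hN]
      have e : (1 - z) * (∑ j ∈ Finset.Ico p N, (B j : ℂ) * z ^ j + B N * z ^ N) +
          (B (N + 1) : ℝ) * z ^ (N + 1) =
          ((1 - z) * ∑ j ∈ Finset.Ico p N, (B j : ℂ) * z ^ j + B N * z ^ N) -
            ((B N - B (N + 1) : ℝ) : ℂ) * z ^ (N + 1) := by
        push_cast; ring
      rw [e]
      refine (norm_sub_le _ _).trans ?_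
      rw [norm_mul, norm_pow, hz, one_pow, mul_one, Complex.norm_real, Real.norm_eq_abs,
        abs_of_nonneg (sub_nonneg.2 (hB N.le_succ))]
      linarith
  have h2 : ‖(B N : ℂ) * z ^ N‖ = B N := by
    rw [norm_mul, norm_pow, hz, one_pow, mul_one, Complex.norm_real, Real.norm_eq_abs,
      abs_of_nonneg (hB0 N)]
  have h3 := norm_sub_le ((1 - z) * ∑ j ∈ Finset.Ico p N, (B j : ℂ) * z ^ j + B N * z ^ N)
    ((B N : ℂ) * z ^ N)
  rw [add_sub_cancel_right, h2] at h3
  linarith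

variable {a : ℝ}

lemma norm_sum_range_cesaroNumber_le (ha : a ∈ Ioo (0 : ℝ) 1) {z : ℂ} (hz : ‖z‖ = 1) (n : ℕ) :
    ‖∑ j ∈ Finset.range n, (cesaroNumber (-a) j : ℂ) * z ^ j‖ ≤
      (1 - a)⁻¹ * (n : ℝ) ^ (1 - a) := by
  refine (norm_sum_le _ _).trans ((Finset.sum_le_sum fun j _ => ?_).trans
    (sum_cesaroNumber_neg_le ha n))
  rw [norm_mul, norm_pow, hz, one_pow, mul_one, Complex.norm_real, Real.norm_eq_abs,
    abs_of_pos (cesaroNumber_neg_pos ha j)]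

/-- Split at `M = ⌈1/s⌉`. The first `M` terms are summed in absolute value, giving order `M^(1-a)`.
For the others Abel's inequality gains `1/|1 - z|`, of order `1/s`, on the leading coefficient,
which is at most `s^a`. The bound does not depend on `N`. -/
lemma norm_cesaroPoly_le (ha : a ∈ Ioo (0 : ℝ) 1) (N : ℕ) {s : ℝ} (hs : 0 < s)
    (hs' : s ≤ Real.pi) :
    ‖cesaroPoly (-a) N (Complex.exp (Complex.I * s))‖ ≤
      (5 * (1 - a)⁻¹ + Real.pi) * s ^ (a - 1) := by
  have hz := norm_exp_I_mul s
  have hlow := le_norm_one_sub_exp hs.le hs'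
  set z := Complex.exp (Complex.I * s)
  have h1a : 0 < 1 - a := by linarith [ha.2]
  have hπ := Real.pi_pos
  set M := ⌈1 / s⌉₊
  have hM1 : (M : ℝ) ≤ 5 / s := by
    have h1 : (M : ℝ) < 1 / s + 1 := Nat.ceil_lt_add_one (by positivity)
    -- The 5 is `1 + 4`, since `s ≤ π ≤ 4`.
    have h2 : 1 / s + 1 ≤ 5 / s := by
      rw [div_add_one hs.ne', div_le_div_iff_of_pos_right hs]
      linarith [Real.pi_le_four]
    linarith
  have hM2 : 1 / s ≤ M := Nat.le_ceil _
  have hMpow : (1 - a)⁻¹ * (M : ℝ) ^ (1 - a) ≤ 5 * (1 - a)⁻¹ * s ^ (a - 1) := by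
    have h1 : (M : ℝ) ^ (1 - a) ≤ (5 / s) ^ (1 - a) :=
      Real.rpow_le_rpow (by positivity) hM1 h1a.le
    have h2 : (5 / s) ^ (1 - a) ≤ 5 * s ^ (a - 1) := by
      rw [Real.div_rpow (by norm_num) hs.le, show a - 1 = -(1 - a) by ring, Real.rpow_neg hs.le,
        div_eq_mul_inv]
      refine mul_le_mul_of_nonneg_right ?_ (by positivity)
      calc (5 : ℝ) ^ (1 - a) ≤ 5 ^ (1 : ℝ) :=
            Real.rpow_le_rpow_of_exponent_le (by norm_num) (by linarith [ha.1])
        _ = 5 := by simp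
    calc _ ≤ (1 - a)⁻¹ * (5 * s ^ (a - 1)) :=
          mul_le_mul_of_nonneg_left (h1.trans h2) (by positivity)
      _ = _ := by ring
  unfold cesaroPoly
  rcases le_total (N + 1) M with h | h
  · refine (norm_sum_range_cesaroNumber_le ha hz (N + 1)).trans ?_
    calc (1 - a)⁻¹ * ((N + 1 : ℕ) : ℝ) ^ (1 - a) ≤ (1 - a)⁻¹ * (M : ℝ) ^ (1 - a) := by
          refine mul_le_mul_of_nonneg_left (Real.rpow_le_rpow (by positivity) ?_ h1a.le)
            (by positivity)
          exact_mod_cast h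
      _ ≤ 5 * (1 - a)⁻¹ * s ^ (a - 1) := hMpow
      _ ≤ _ := by
          refine mul_le_mul_of_nonneg_right ?_ (by positivity)
          linarith
  · rw [← Finset.sum_range_add_sum_Ico _ h]
    refine (norm_add_le _ _).trans ?_
    rw [add_mul]
    refine add_le_add ((norm_sum_range_cesaroNumber_le ha hz M).trans hMpow) ?_
    have hA := norm_one_sub_mul_sum_Ico_le (cesaroNumber_neg_antitone ha)
      (fun j => (cesaroNumber_neg_pos ha j).le) hz h
    have hB : cesaroNumber (-a) M ≤ s ^ a := by
      refine (cesaroNumber_neg_le ha M).trans ?_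
      calc ((M : ℝ) + 1) ^ (-a) ≤ (1 / s) ^ (-a) :=
            Real.rpow_le_rpow_of_nonpos (by positivity) (by linarith) (by linarith [ha.1])
        _ = s ^ a := by rw [one_div, Real.inv_rpow hs.le, Real.rpow_neg hs.le, inv_inv]
    rw [norm_mul] at hA
    have h5 : 2 / Real.pi * s * ‖∑ j ∈ Finset.Ico M (N + 1), (cesaroNumber (-a) j : ℂ) * z ^ j‖
        ≤ 2 * s ^ a :=
      (mul_le_mul_of_nonneg_right hlow (norm_nonneg _)).trans (hA.trans (by linarith))
    rw [Real.rpow_sub_one hs.ne', mul_div_assoc', le_div_iff₀ hs]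
    have h6 := mul_le_mul_of_nonneg_left h5 (show 0 ≤ Real.pi / 2 by positivity)
    calc _ = Real.pi / 2 * (2 / Real.pi * s *
          ‖∑ j ∈ Finset.Ico M (N + 1), (cesaroNumber (-a) j : ℂ) * z ^ j‖) := by field_simp
      _ ≤ Real.pi / 2 * (2 * s ^ a) := h6
      _ = _ := by ring

lemma exp_I_mul_ne_one {s : ℝ} (hs : 0 < s) (hs' : s ≤ Real.pi) :
    Complex.exp (Complex.I * s) ≠ 1 := by
  intro h
  have := le_norm_one_sub_exp hs.le hs'
  rw [h, sub_self, norm_zero] at this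
  have hπ := Real.pi_pos
  have : 0 < 2 / Real.pi * s := by positivity
  linarith

lemma inv_norm_one_sub_exp_le {s : ℝ} (hs : 0 < s) (hs' : s ≤ Real.pi) :
    ‖1 - Complex.exp (Complex.I * s)‖⁻¹ ≤ Real.pi / 2 * s⁻¹ := by
  have hπ := Real.pi_pos
  have := inv_anti₀ (by positivity) (le_norm_one_sub_exp hs.le hs')
  rwa [mul_inv, inv_div] at this

lemma kernelQuotient_eq (a : ℝ) (n : ℕ) {s : ℝ} (hz : Complex.exp (Complex.I * s) ≠ 1) :
    kernelQuotient a n s = cesaroPoly (-a) n (Complex.exp (Complex.I * s)) +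
      (cesaroNumber (-a) n : ℂ) * Complex.exp (Complex.I * s) ^ (n + 1) /
        (1 - Complex.exp (Complex.I * s)) := by
  have h := one_sub_mul_cesaroPoly (-a) n (Complex.exp (Complex.I * s))
  have h2 : 1 - Complex.exp (Complex.I * s) ≠ 0 := sub_ne_zero.2 hz.symm
  unfold kernelQuotient
  rw [div_eq_iff h2, add_mul, div_mul_cancel₀ _ h2]
  linear_combination -h

/-- The boundary terms of `kernelQuotient_eq` at `s` and `-s` are each singular at `0`, but they
combine to the constant `-1`, because `z⁻¹/(1 - z⁻¹) + z/(1 - z) = -1`. -/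
lemma norm_cesaroKernel_le (ha : a ∈ Ioo (0 : ℝ) 1) (n : ℕ) {s : ℝ} (hs : 0 < s)
    (hs' : s ≤ Real.pi) :
    ‖cesaroKernel a n s‖ ≤ 2 * (cesaroNumber (-a) n)⁻¹ *
      ‖cesaroPoly (-a) n (Complex.exp (Complex.I * s))‖ + 1 := by
  have hz := exp_I_mul_ne_one hs hs'
  have hzi : Complex.exp (Complex.I * ((-s : ℝ) : ℂ)) ≠ 1 := by
    rw [exp_neg_I_mul]; exact fun h => hz (by rw [← inv_inv (Complex.exp _), h, inv_one])
  have hB := cesaroNumber_neg_pos ha n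
  have hB' : (cesaroNumber (-a) n : ℂ) ≠ 0 := by exact_mod_cast hB.ne'
  have hconj : ‖cesaroPoly (-a) n (Complex.exp (Complex.I * s))⁻¹‖ =
      ‖cesaroPoly (-a) n (Complex.exp (Complex.I * s))‖ := by
    rw [← exp_neg_I_mul, ← Complex.norm_conj (cesaroPoly (-a) n (Complex.exp (Complex.I * s)))]
    have e : (starRingEnd ℂ) (Complex.exp (Complex.I * s)) =
        Complex.exp (Complex.I * ((-s : ℝ) : ℂ)) := by
      rw [← Complex.exp_conj]; simp
    unfold cesaroPoly
    simp only [map_sum, map_mul, map_pow, e, Complex.conj_ofReal]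
  rw [cesaroKernel_eq a n s hz, kernelQuotient_eq a n hz, kernelQuotient_eq a n hzi,
    exp_neg_I_mul]
  have hnz := norm_exp_I_mul s
  have hz0 : Complex.exp (Complex.I * s) ≠ 0 := Complex.exp_ne_zero _
  set z := Complex.exp (Complex.I * s)
  have h2 : 1 - z ≠ 0 := sub_ne_zero.2 hz.symm
  have h3 : 1 - z⁻¹ ≠ 0 := by
    rw [sub_ne_zero]; exact fun h => hz (by rw [← inv_inv z, ← h, inv_one])
  have h4 : z - 1 ≠ 0 := sub_ne_zero.2 hz
  have hp : z ^ n * z⁻¹ ^ n = 1 := by rw [← mul_pow, mul_inv_cancel₀ hz0, one_pow]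
  have hr : z⁻¹ / (1 - z⁻¹) + z / (1 - z) = -1 := by
    have : z⁻¹ / (1 - z⁻¹) = - (1 / (1 - z)) := by
      rw [← neg_sub z 1]; field_simp
    rw [this]; field_simp; ring
  have e : 1 / (cesaroNumber (-a) n : ℂ) *
      (z ^ n * (cesaroPoly (-a) n z⁻¹ + (cesaroNumber (-a) n : ℂ) * z⁻¹ ^ (n + 1) / (1 - z⁻¹)) +
        z⁻¹ ^ n * (cesaroPoly (-a) n z + (cesaroNumber (-a) n : ℂ) * z ^ (n + 1) / (1 - z))) =
      (cesaroNumber (-a) n : ℂ)⁻¹ * (z ^ n * cesaroPoly (-a) n z⁻¹ + z⁻¹ ^ n * cesaroPoly (-a) n z)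
        - 1 := by
    have e1 : z ^ n * ((cesaroNumber (-a) n : ℂ) * z⁻¹ ^ (n + 1) / (1 - z⁻¹)) +
        z⁻¹ ^ n * ((cesaroNumber (-a) n : ℂ) * z ^ (n + 1) / (1 - z)) =
        -(cesaroNumber (-a) n : ℂ) := by
      calc _ = (cesaroNumber (-a) n : ℂ) * (z ^ n * z⁻¹ ^ n) *
            (z⁻¹ / (1 - z⁻¹) + z / (1 - z)) := by
            rw [pow_succ, pow_succ]; ring
        _ = _ := by rw [hp, hr]; ring
    rw [mul_add (z ^ n), mul_add (z⁻¹ ^ n), add_add_add_comm, e1, one_div, mul_add, mul_neg,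
      inv_mul_cancel₀ hB', ← sub_eq_add_neg]
  rw [e]
  refine (norm_sub_le _ _).trans ?_
  rw [norm_one]
  refine add_le_add_left ?_ 1
  rw [norm_mul, norm_inv, Complex.norm_real, Real.norm_eq_abs, abs_of_pos hB]
  have h5 : ‖z ^ n * cesaroPoly (-a) n z⁻¹ + z⁻¹ ^ n * cesaroPoly (-a) n z‖ ≤
      2 * ‖cesaroPoly (-a) n z‖ := by
    refine (norm_add_le _ _).trans (le_of_eq ?_)
    rw [norm_mul, norm_mul, norm_pow, norm_pow, norm_inv, hnz, hconj]
    simp; ring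
  calc _ ≤ (cesaroNumber (-a) n)⁻¹ * (2 * ‖cesaroPoly (-a) n z‖) :=
        mul_le_mul_of_nonneg_left h5 (by positivity)
    _ = _ := by ring

lemma exists_norm_cesaroKernel_le (ha : a ∈ Ioo (0 : ℝ) 1) :
    ∃ C, 0 < C ∧ ∀ n : ℕ, 1 ≤ n → ∀ s : ℝ, 0 < s → s ≤ Real.pi →
      ‖cesaroKernel a n s‖ ≤ C * n ∧ ‖cesaroKernel a n s‖ ≤ C * ((n : ℝ) ^ a * s ^ (a - 1)) := by
  have h1a : 0 < 1 - a := by linarith [ha.2]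
  have hπ := Real.pi_pos
  set D := 5 * (1 - a)⁻¹ + Real.pi with hD
  have hDpos : 0 < D := by positivity
  refine ⟨4 * (1 - a)⁻¹ * (1 - a)⁻¹ + 2 * (1 - a)⁻¹ * D + 4, by positivity, ?_⟩
  intro n hn s hs hs'
  have hn1 : (1 : ℝ) ≤ n := by exact_mod_cast hn
  have hn0 : (0 : ℝ) < n := by linarith
  have h := norm_cesaroKernel_le ha n hs hs'
  have hBi := inv_cesaroNumber_neg_le ha hn
  have hBp := cesaroNumber_neg_pos ha n
  constructor
  · have hP : ‖cesaroPoly (-a) n (Complex.exp (Complex.I * s))‖ ≤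
        (1 - a)⁻¹ * (2 * (n : ℝ) ^ (1 - a)) := by
      refine (norm_sum_range_cesaroNumber_le ha (norm_exp_I_mul s) (n + 1)).trans ?_
      refine mul_le_mul_of_nonneg_left ?_ (by positivity)
      calc ((n + 1 : ℕ) : ℝ) ^ (1 - a) ≤ (2 * n : ℝ) ^ (1 - a) := by
            refine Real.rpow_le_rpow (by positivity) ?_ h1a.le
            push_cast; linarith
        _ = 2 ^ (1 - a) * (n : ℝ) ^ (1 - a) := Real.mul_rpow (by norm_num) hn0.le
        _ ≤ 2 * (n : ℝ) ^ (1 - a) := by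
            refine mul_le_mul_of_nonneg_right ?_ (by positivity)
            calc (2 : ℝ) ^ (1 - a) ≤ 2 ^ (1 : ℝ) :=
                  Real.rpow_le_rpow_of_exponent_le (by norm_num) (by linarith [ha.1])
              _ = 2 := by simp
    have hnn : (n : ℝ) ^ a * (n : ℝ) ^ (1 - a) = n := by
      rw [← Real.rpow_add hn0]; simp
    have h2 : 2 * (cesaroNumber (-a) n)⁻¹ * ‖cesaroPoly (-a) n (Complex.exp (Complex.I * s))‖ ≤
        2 * ((1 - a)⁻¹ * (n : ℝ) ^ a) * ((1 - a)⁻¹ * (2 * (n : ℝ) ^ (1 - a))) := by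
      gcongr
    have h3 : 2 * ((1 - a)⁻¹ * (n : ℝ) ^ a) * ((1 - a)⁻¹ * (2 * (n : ℝ) ^ (1 - a))) =
        4 * (1 - a)⁻¹ * (1 - a)⁻¹ * n := by
      linear_combination 4 * (1 - a)⁻¹ * (1 - a)⁻¹ * hnn
    have h4 : 0 ≤ 2 * (1 - a)⁻¹ * D * n := by positivity
    calc _ ≤ 4 * (1 - a)⁻¹ * (1 - a)⁻¹ * n + 4 * n := by linarith
      _ ≤ _ := by linarith
  · have h2 : 2 * (cesaroNumber (-a) n)⁻¹ * ‖cesaroPoly (-a) n (Complex.exp (Complex.I * s))‖ ≤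
        2 * ((1 - a)⁻¹ * (n : ℝ) ^ a) * (D * s ^ (a - 1)) := by
      have := norm_cesaroPoly_le ha n hs hs'
      gcongr
    -- The additive 1 from `norm_cesaroKernel_le` is absorbed, using `s ≤ π ≤ 4` and `n ≥ 1`.
    have h3 : 1 ≤ 4 * ((n : ℝ) ^ a * s ^ (a - 1)) := by
      have h4 : (1 : ℝ) ≤ (n : ℝ) ^ a := Real.one_le_rpow hn1 ha.1.le
      have h5 : (1 / 4 : ℝ) ≤ s ^ (a - 1) := by
        calc (1 / 4 : ℝ) = 4 ^ (-1 : ℝ) := by rw [Real.rpow_neg_one]; norm_num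
          _ ≤ 4 ^ (a - 1) :=
            Real.rpow_le_rpow_of_exponent_le (by norm_num) (by linarith [ha.1])
          _ ≤ s ^ (a - 1) := Real.rpow_le_rpow_of_nonpos hs
            (hs'.trans Real.pi_le_four) (by linarith)
      nlinarith
    have h6 : 0 ≤ 4 * (1 - a)⁻¹ * (1 - a)⁻¹ * ((n : ℝ) ^ a * s ^ (a - 1)) := by positivity
    calc _ ≤ 2 * ((1 - a)⁻¹ * (n : ℝ) ^ a) * (D * s ^ (a - 1)) +
          4 * ((n : ℝ) ^ a * s ^ (a - 1)) := by linarith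
      _ ≤ _ := by linarith

/-- The numerator of the quotient has size `s^a` and derivative of size `s^(a-1)`, while the
denominator has size `s`. A difference version of the quotient rule gives `s^(a-2)`. The condition
`s ≥ 1/n` is what makes the boundary coefficient at most `s^a`. -/
lemma norm_kernelQuotient_sub_le (ha : a ∈ Ioo (0 : ℝ) 1) {n : ℕ} (hn : 1 ≤ n) {s t : ℝ}
    (hs : 1 / (n : ℝ) ≤ s) (hst : s ≤ t) (ht : t ≤ Real.pi) :
    ‖kernelQuotient a n s - kernelQuotient a n t‖ ≤
      (5 * (1 - a)⁻¹ + 10) * 10 * ((t - s) * s ^ (a - 2)) := by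
  have h1a : 0 < 1 - a := by linarith [ha.2]
  have hπ := Real.pi_pos
  have hπ4 := Real.pi_le_four
  have hn0 : (0 : ℝ) < n := by exact_mod_cast hn
  have hs0 : 0 < s := lt_of_lt_of_le (by positivity) hs
  have ht0 : 0 < t := hs0.trans_le hst
  set D := 5 * (1 - a)⁻¹ + Real.pi with hD
  have hDpos : 0 < D := by positivity
  obtain ⟨k, rfl⟩ : ∃ k, n = k + 1 := ⟨n - 1, by omega⟩
  have hH : ‖cesaroPoly (-a - 1) (k + 1) (Complex.exp (Complex.I * t)) -
      cesaroPoly (-a - 1) (k + 1) (Complex.exp (Complex.I * s))‖ ≤ D * s ^ (a - 1) * (t - s) := by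
    have := Convex.norm_image_sub_le_of_norm_hasDerivWithin_le (𝕜 := ℝ) (s := Icc s t)
      (fun x _ => (hasDerivAt_cesaroPoly_exp (-a) k x).hasDerivWithinAt)
      (C := D * s ^ (a - 1)) ?_ (convex_Icc s t) (left_mem_Icc.2 hst) (right_mem_Icc.2 hst)
    · rwa [Real.norm_eq_abs, abs_of_nonneg (sub_nonneg.2 hst)] at this
    · intro x hx
      have hx0 : 0 < x := hs0.trans_le hx.1
      rw [norm_mul, norm_mul, norm_mul, norm_exp_I_mul, Complex.norm_I, Complex.norm_real,
        Real.norm_eq_abs, abs_neg, abs_of_pos ha.1, mul_one, mul_one]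
      calc a * ‖cesaroPoly (-a) k (Complex.exp (Complex.I * x))‖
          ≤ 1 * ‖cesaroPoly (-a) k (Complex.exp (Complex.I * x))‖ :=
            mul_le_mul_of_nonneg_right ha.2.le (norm_nonneg _)
        _ ≤ D * x ^ (a - 1) := by
            rw [one_mul]; exact norm_cesaroPoly_le ha k hx0 (hx.2.trans ht)
        _ ≤ D * s ^ (a - 1) := mul_le_mul_of_nonneg_left
            (Real.rpow_le_rpow_of_nonpos hs0 hx.1 (by linarith)) hDpos.le
  -- The polynomial of order `-a - 1` is `(1 - z)` times that of order `-a`, plus a boundary term.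
  have hHs : ‖cesaroPoly (-a - 1) (k + 1) (Complex.exp (Complex.I * s))‖ ≤ (D + 1) * s ^ a := by
    have e := one_sub_mul_cesaroPoly (-a) (k + 1) (Complex.exp (Complex.I * s))
    rw [eq_sub_iff_add_eq] at e
    rw [← e]
    refine (norm_add_le _ _).trans ?_
    rw [add_mul]
    refine add_le_add ?_ ?_
    · rw [norm_mul]
      have h1 : ‖1 - Complex.exp (Complex.I * s)‖ ≤ s := by
        have := norm_exp_sub_exp_le s 0
        simpa [abs_of_pos hs0] using this
      calc _ ≤ s * (D * s ^ (a - 1)) :=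
            mul_le_mul h1 (norm_cesaroPoly_le ha _ hs0 (hst.trans ht)) (norm_nonneg _) hs0.le
        _ = D * s ^ a := by rw [Real.rpow_sub_one hs0.ne']; field_simp
    · rw [norm_mul, norm_pow, norm_exp_I_mul, one_pow, mul_one, Complex.norm_real,
        Real.norm_eq_abs, abs_of_pos (cesaroNumber_neg_pos ha _), one_mul]
      refine (cesaroNumber_neg_le ha _).trans ?_
      calc (((k + 1 : ℕ) : ℝ) + 1) ^ (-a) ≤ (1 / s) ^ (-a) := by
            refine Real.rpow_le_rpow_of_nonpos (by positivity) ?_ (by linarith [ha.1])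
            have : 1 / s ≤ ((k + 1 : ℕ) : ℝ) := (one_div_le hn0 hs0).1 hs
            linarith
        _ = s ^ a := by rw [one_div, Real.inv_rpow hs0.le, Real.rpow_neg hs0.le, inv_inv]
  have hzs := exp_I_mul_ne_one hs0 (hst.trans ht)
  have hzt := exp_I_mul_ne_one ht0 ht
  have his := inv_norm_one_sub_exp_le hs0 (hst.trans ht)
  have hit : ‖1 - Complex.exp (Complex.I * t)‖⁻¹ ≤ Real.pi / 2 * s⁻¹ :=
    (inv_norm_one_sub_exp_le ht0 ht).trans (by gcongr)
  have hz := norm_exp_sub_exp_le s t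
  rw [abs_of_nonneg (sub_nonneg.2 hst)] at hz
  unfold kernelQuotient
  set z := Complex.exp (Complex.I * s)
  set w := Complex.exp (Complex.I * t)
  have h2 : 1 - z ≠ 0 := sub_ne_zero.2 hzs.symm
  have h3 : 1 - w ≠ 0 := sub_ne_zero.2 hzt.symm
  have e : cesaroPoly (-a - 1) (k + 1) z / (1 - z) - cesaroPoly (-a - 1) (k + 1) w / (1 - w) =
      -((cesaroPoly (-a - 1) (k + 1) w - cesaroPoly (-a - 1) (k + 1) z) * (1 - w)⁻¹) -
        cesaroPoly (-a - 1) (k + 1) z * ((w - z) * (1 - z)⁻¹ * (1 - w)⁻¹) := by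
    field_simp; ring
  rw [e]
  refine (norm_sub_le _ _).trans ?_
  rw [norm_neg, norm_mul, norm_mul, norm_mul, norm_mul, norm_inv, norm_inv]
  have hts : 0 ≤ t - s := sub_nonneg.2 hst
  have b1 : ‖cesaroPoly (-a - 1) (k + 1) w - cesaroPoly (-a - 1) (k + 1) z‖ * ‖1 - w‖⁻¹ ≤
      D * s ^ (a - 1) * (t - s) * (Real.pi / 2 * s⁻¹) := by gcongr
  have b2 : ‖cesaroPoly (-a - 1) (k + 1) z‖ * (‖w - z‖ * ‖1 - z‖⁻¹ * ‖1 - w‖⁻¹) ≤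
      (D + 1) * s ^ a * ((t - s) * (Real.pi / 2 * s⁻¹) * (Real.pi / 2 * s⁻¹)) := by gcongr
  have p1 : s ^ (a - 1) = s ^ (a - 2) * s := by
    rw [← Real.rpow_add_one hs0.ne']; congr 1; ring
  have p2 : s ^ a = s ^ (a - 2) * s * s := by
    rw [← p1, ← Real.rpow_add_one hs0.ne']; congr 1; ring
  have hX : 0 ≤ (t - s) * s ^ (a - 2) := by positivity
  have c1 : D * s ^ (a - 1) * (t - s) * (Real.pi / 2 * s⁻¹) =
      D * (Real.pi / 2) * ((t - s) * s ^ (a - 2)) := by rw [p1]; field_simp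
  have c2 : (D + 1) * s ^ a * ((t - s) * (Real.pi / 2 * s⁻¹) * (Real.pi / 2 * s⁻¹)) =
      (D + 1) * (Real.pi / 2 * (Real.pi / 2)) * ((t - s) * s ^ (a - 2)) := by
    rw [p2]; field_simp
  rw [c1] at b1
  rw [c2] at b2
  refine (add_le_add b1 b2).trans ?_
  rw [← add_mul]
  refine mul_le_mul_of_nonneg_right ?_ hX
  have hA : 0 < (1 - a)⁻¹ := by positivity
  have d1 : D * (Real.pi / 2) ≤ (5 * (1 - a)⁻¹ + 4) * 2 := by gcongr <;> linarith
  have d2 : (D + 1) * (Real.pi / 2 * (Real.pi / 2)) ≤ (5 * (1 - a)⁻¹ + 4 + 1) * (2 * 2) := by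
    gcongr <;> linarith
  linarith

/-- Translation by `π/n` replaces `z^n` by `-z^n`, so the sum of two kernel values becomes a
difference of quotients. -/
lemma norm_cesaroKernel_add_le (ha : a ∈ Ioo (0 : ℝ) 1) {n : ℕ} (hn : 1 ≤ n) {s : ℝ}
    (hs : 0 < s) (hs' : s + Real.pi / n ≤ Real.pi) :
    ‖cesaroKernel a n s + cesaroKernel a n (s + Real.pi / n)‖ ≤
      2 * (cesaroNumber (-a) n)⁻¹ *
        ‖kernelQuotient a n s - kernelQuotient a n (s + Real.pi / n)‖ := by
  have hπ := Real.pi_pos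
  have hn0 : (0 : ℝ) < n := by exact_mod_cast hn
  have hh : 0 < Real.pi / n := by positivity
  have hB := cesaroNumber_neg_pos ha n
  set t := s + Real.pi / n with ht
  have hzs := exp_I_mul_ne_one hs (by linarith)
  have hzt := exp_I_mul_ne_one (s := t) (by linarith) hs'
  have hpow : Complex.exp (Complex.I * t) ^ n = -Complex.exp (Complex.I * s) ^ n := by
    rw [← Complex.exp_nat_mul, ← Complex.exp_nat_mul]
    have : (n : ℂ) * (Complex.I * t) = n * (Complex.I * s) + Real.pi * Complex.I := by
      have : (n : ℂ) ≠ 0 := by exact_mod_cast hn0.ne'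
      rw [ht]; push_cast; field_simp
    rw [this, Complex.exp_add, Complex.exp_pi_mul_I]; ring
  rw [cesaroKernel_eq a n s hzs, cesaroKernel_eq a n t hzt, inv_pow, inv_pow, hpow,
    kernelQuotient_neg, kernelQuotient_neg]
  have hnz : ‖Complex.exp (Complex.I * s) ^ n‖ = 1 := by rw [norm_pow, norm_exp_I_mul, one_pow]
  set y := Complex.exp (Complex.I * s) ^ n
  have e : 1 / (cesaroNumber (-a) n : ℂ) * (y * (starRingEnd ℂ) (kernelQuotient a n s) +
        y⁻¹ * kernelQuotient a n s) +
      1 / (cesaroNumber (-a) n : ℂ) * (-y * (starRingEnd ℂ) (kernelQuotient a n t) +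
        (-y)⁻¹ * kernelQuotient a n t) =
      (cesaroNumber (-a) n : ℂ)⁻¹ *
        (y * (starRingEnd ℂ) (kernelQuotient a n s - kernelQuotient a n t) +
          y⁻¹ * (kernelQuotient a n s - kernelQuotient a n t)) := by
    rw [map_sub, inv_neg]; ring
  rw [e, norm_mul, norm_inv, Complex.norm_real, Real.norm_eq_abs, abs_of_pos hB]
  have h5 : ‖y * (starRingEnd ℂ) (kernelQuotient a n s - kernelQuotient a n t) +
      y⁻¹ * (kernelQuotient a n s - kernelQuotient a n t)‖ ≤
      2 * ‖kernelQuotient a n s - kernelQuotient a n t‖ := by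
    refine (norm_add_le _ _).trans (le_of_eq ?_)
    rw [norm_mul, norm_mul, norm_inv, hnz, Complex.norm_conj]
    ring
  calc _ ≤ (cesaroNumber (-a) n)⁻¹ * (2 * ‖kernelQuotient a n s - kernelQuotient a n t‖) :=
        mul_le_mul_of_nonneg_left h5 (by positivity)
    _ = _ := by ring

/-! ### The kernel on a grid of step `π/n` -/

lemma rpow_natCast_le_four_mul {p : ℝ} (hp : -2 ≤ p) (hp0 : p ≤ 0) {k : ℕ} (hk : 1 ≤ k) :
    (k : ℝ) ^ p ≤ 4 * ((k : ℝ) + 1) ^ p := by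
  have hk1 : (1 : ℝ) ≤ k := by exact_mod_cast hk
  have h3 : (2 * (k : ℝ)) ^ p ≤ ((k : ℝ) + 1) ^ p :=
    Real.rpow_le_rpow_of_nonpos (by positivity) (by linarith) hp0
  rw [Real.mul_rpow (by norm_num) (by positivity)] at h3
  have h4 : (1 / 4 : ℝ) ≤ 2 ^ p := by
    have : (2 : ℝ) ^ (-2 : ℝ) ≤ 2 ^ p := Real.rpow_le_rpow_of_exponent_le (by norm_num) hp
    refine le_trans (le_of_eq ?_) this
    rw [Real.rpow_neg (by norm_num)]; norm_num
  have h5 : 0 ≤ (k : ℝ) ^ p := by positivity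
  nlinarith

/-- Bounds for the kernel on an arithmetic progression with difference `π / n`. -/
lemma exists_norm_cesaroKernel_grid_le (ha : a ∈ Ioo (0 : ℝ) 1) :
    ∃ C, 0 < C ∧ ∀ n : ℕ, 1 ≤ n → ∀ u ∈ Ioc (0 : ℝ) (Real.pi / n),
      (∀ k < n, ‖cesaroKernel a n (u + k * (Real.pi / n))‖ ≤ C * n * ((k : ℝ) + 1) ^ (a - 1)) ∧
      (∀ k, k + 1 < n → ‖cesaroKernel a n (u + k * (Real.pi / n)) +
        cesaroKernel a n (u + (k + 1 : ℕ) * (Real.pi / n))‖ ≤ C * n * ((k : ℝ) + 1) ^ (a - 2)) := by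
  obtain ⟨C, hC, hK⟩ := exists_norm_cesaroKernel_le ha
  have h1a : 0 < 1 - a := by linarith [ha.2]
  have hπ := Real.pi_pos
  -- Of the two factors 4, one bounds `π` and the other replaces `k` by `k + 1` in the power.
  set E := 2 * (1 - a)⁻¹ * ((5 * (1 - a)⁻¹ + 10) * 10) * 4 * 4 with hE
  have hEpos : 0 < E := by positivity
  refine ⟨4 * C + E, by positivity, ?_⟩
  intro n hn u hu
  have hn0 : (0 : ℝ) < n := by exact_mod_cast hn
  have hh : 0 < Real.pi / n := by positivity
  have hgrid : ∀ k : ℕ, k < n → 0 < u + k * (Real.pi / n) ∧ u + k * (Real.pi / n) ≤ Real.pi := by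
    intro k hk
    refine ⟨by have := hu.1; positivity, ?_⟩
    have h1 : (k : ℝ) + 1 ≤ n := by exact_mod_cast hk
    calc u + k * (Real.pi / n) ≤ (k + 1) * (Real.pi / n) := by linarith [hu.2]
      _ ≤ n * (Real.pi / n) := by gcongr
      _ = Real.pi := by field_simp
  have hlow : ∀ k : ℕ, (k : ℝ) / n ≤ u + k * (Real.pi / n) := by
    intro k
    have h1 : (k : ℝ) / n ≤ k * (Real.pi / n) := by
      rw [mul_div_assoc', div_le_div_iff_of_pos_right hn0]
      exact le_mul_of_one_le_right (by positivity) (by linarith [Real.pi_gt_three])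
    linarith [hu.1]
  have first : ∀ k < n, ‖cesaroKernel a n (u + k * (Real.pi / n))‖ ≤
      4 * C * n * ((k : ℝ) + 1) ^ (a - 1) := by
    intro k hk
    have hg := hgrid k hk
    rcases Nat.eq_zero_or_pos k with rfl | hk0
    · refine (hK n hn _ hg.1 hg.2).1.trans ?_
      simp only [Nat.cast_zero, zero_add, Real.one_rpow, mul_one]
      nlinarith [mul_pos hC hn0]
    · have hk0' : (0 : ℝ) < k := by exact_mod_cast hk0
      refine (hK n hn _ hg.1 hg.2).2.trans ?_
      have h1 : (u + k * (Real.pi / n)) ^ (a - 1) ≤ ((k : ℝ) / n) ^ (a - 1) :=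
        Real.rpow_le_rpow_of_nonpos (by positivity) (hlow k) (by linarith)
      have h2 := rpow_natCast_le_four_mul (p := a - 1) (by linarith [ha.1]) (by linarith) hk0
      have h3 : (n : ℝ) ^ a * ((k : ℝ) / n) ^ (a - 1) = n * (k : ℝ) ^ (a - 1) := by
        rw [Real.div_rpow hk0'.le hn0.le, Real.rpow_sub_one hn0.ne']
        field_simp
      calc _ ≤ C * ((n : ℝ) ^ a * ((k : ℝ) / n) ^ (a - 1)) := by gcongr
        _ = C * n * (k : ℝ) ^ (a - 1) := by rw [h3]; ring
        _ ≤ C * n * (4 * ((k : ℝ) + 1) ^ (a - 1)) := by gcongr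
        _ = _ := by ring
  refine ⟨fun k hk => (first k hk).trans ?_, fun k hk => ?_⟩
  · gcongr; linarith
  · rcases Nat.eq_zero_or_pos k with rfl | hk0
    -- At the first grid point no cancellation is needed: both values are at most `C n`.
    · refine (norm_add_le _ _).trans ?_
      have h1 := hK n hn _ (hgrid 0 (by omega)).1 (hgrid 0 (by omega)).2
      have h2 := hK n hn _ (hgrid (0 + 1) hk).1 (hgrid (0 + 1) hk).2
      simp only [Nat.cast_zero, zero_add, Real.one_rpow, mul_one] at h1 h2 ⊢
      nlinarith [h1.1, h2.1, mul_pos hC hn0, mul_pos hEpos hn0]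
    · have hk0' : (0 : ℝ) < k := by exact_mod_cast hk0
      have hg := hgrid k (by omega)
      have hg1 := hgrid (k + 1) hk
      have e : u + ((k + 1 : ℕ) : ℝ) * (Real.pi / n) = u + k * (Real.pi / n) + Real.pi / n := by
        push_cast; ring
      rw [e] at hg1 ⊢
      refine (norm_cesaroKernel_add_le ha hn hg.1 hg1.2).trans ?_
      have hs1 : 1 / (n : ℝ) ≤ u + k * (Real.pi / n) := by
        refine le_trans ?_ (hlow k)
        have : (1 : ℝ) ≤ k := by exact_mod_cast hk0
        gcongr
      have hq := norm_kernelQuotient_sub_le ha hn hs1 (by linarith) hg1.2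
      rw [add_sub_cancel_left] at hq
      have h1 : (u + k * (Real.pi / n)) ^ (a - 2) ≤ ((k : ℝ) / n) ^ (a - 2) :=
        Real.rpow_le_rpow_of_nonpos (by positivity) (hlow k) (by linarith)
      have h2 := rpow_natCast_le_four_mul (p := a - 2) (by linarith [ha.1]) (by linarith) hk0
      have h3 : (n : ℝ) ^ a * ((Real.pi / n) * ((k : ℝ) / n) ^ (a - 2)) =
          Real.pi * n * (k : ℝ) ^ (a - 2) := by
        have hnp : (n : ℝ) ^ (a - 2) = (n : ℝ) ^ a / n / n := by
          rw [← Real.rpow_sub_one hn0.ne', ← Real.rpow_sub_one hn0.ne']; congr 1; ring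
        rw [Real.div_rpow hk0'.le hn0.le, hnp]
        field_simp
      have hBi := inv_cesaroNumber_neg_le ha hn
      have hBp := cesaroNumber_neg_pos ha n
      set G := (5 * (1 - a)⁻¹ + 10) * 10 with hG
      have hGpos : 0 < G := by positivity
      calc _ ≤ 2 * ((1 - a)⁻¹ * (n : ℝ) ^ a) * (G * ((Real.pi / n) * ((k : ℝ) / n) ^ (a - 2))) := by
            refine mul_le_mul (by gcongr) (hq.trans (by gcongr)) (norm_nonneg _) (by positivity)
        _ = 2 * (1 - a)⁻¹ * G *
            ((n : ℝ) ^ a * ((Real.pi / n) * ((k : ℝ) / n) ^ (a - 2))) := by ring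
        _ = 2 * (1 - a)⁻¹ * G * (Real.pi * n * (k : ℝ) ^ (a - 2)) := by rw [h3]
        _ ≤ 2 * (1 - a)⁻¹ * G * (4 * n * (4 * ((k : ℝ) + 1) ^ (a - 2))) := by
            have := Real.pi_le_four
            gcongr
        _ = E * n * ((k : ℝ) + 1) ^ (a - 2) := by rw [hE]; ring
        _ ≤ _ := by gcongr; linarith

/-- Tails of an almost alternating sequence. -/
lemma norm_sum_Ico_le_of_alternating (ha : a ∈ Ioo (0 : ℝ) 1) {K : ℕ → ℂ} {n : ℕ} {C : ℝ}
    (hC : 0 ≤ C) (h1 : ∀ k < n, ‖K k‖ ≤ C * ((k : ℝ) + 1) ^ (a - 1))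
    (h2 : ∀ k, k + 1 < n → ‖K k + K (k + 1)‖ ≤ C * ((k : ℝ) + 1) ^ (a - 2)) {k : ℕ} (hk : k < n) :
    ‖∑ i ∈ Finset.Ico k n, K i‖ ≤ C * (1 + 2 / (1 - a)) * ((k : ℝ) + 1) ^ (a - 1) := by
  have h1a : 0 < 1 - a := by linarith [ha.2]
  obtain ⟨m, rfl⟩ : ∃ m, n = m + 1 := ⟨n - 1, by omega⟩
  have hkm : k ≤ m := by omega
  -- Doubling the sum pairs each term with its successor and leaves over only the two end terms.
  have e : 2 * ∑ i ∈ Finset.Ico k (m + 1), K i =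
      K k + K m + ∑ i ∈ Finset.Ico k m, (K i + K (i + 1)) := by
    rw [Finset.sum_add_distrib, Finset.sum_Ico_add' K k m 1, two_mul]
    have e1 := Finset.sum_Ico_succ_top hkm K
    have e2 := Finset.sum_eq_sum_Ico_succ_bot (show k < m + 1 by omega) K
    linear_combination e1 + e2
  have hm : ((m : ℝ) + 1) ^ (a - 1) ≤ ((k : ℝ) + 1) ^ (a - 1) := by
    refine Real.rpow_le_rpow_of_nonpos (by positivity) ?_ (by linarith)
    have : (k : ℝ) ≤ m := by exact_mod_cast hkm
    linarith
  have h3 : ‖∑ i ∈ Finset.Ico k m, (K i + K (i + 1))‖ ≤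
      C * (4 / (1 - a) * ((k : ℝ) + 1) ^ (a - 1)) := by
    refine (norm_sum_le _ _).trans ?_
    refine (Finset.sum_le_sum fun i hi => h2 i (by have := (Finset.mem_Ico.1 hi).2; omega)).trans ?_
    rw [← Finset.mul_sum]
    exact mul_le_mul_of_nonneg_left (sum_Ico_rpow_sub_two_le ha.1.le ha.2 k m) hC
  have h4 : ‖2 * ∑ i ∈ Finset.Ico k (m + 1), K i‖ ≤ C * ((k : ℝ) + 1) ^ (a - 1) +
      C * ((k : ℝ) + 1) ^ (a - 1) + C * (4 / (1 - a) * ((k : ℝ) + 1) ^ (a - 1)) := by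
    rw [e]
    refine (norm_add_le _ _).trans (add_le_add ((norm_add_le _ _).trans ?_) h3)
    exact add_le_add (h1 k hk) ((h1 m (by omega)).trans (mul_le_mul_of_nonneg_left hm hC))
  rw [norm_mul, Complex.norm_ofNat] at h4
  have : C * (1 + 2 / (1 - a)) * ((k : ℝ) + 1) ^ (a - 1) = (C * ((k : ℝ) + 1) ^ (a - 1) +
      C * ((k : ℝ) + 1) ^ (a - 1) + C * (4 / (1 - a) * ((k : ℝ) + 1) ^ (a - 1))) / 2 := by ring
  rw [this, le_div_iff₀ (by norm_num)]
  linarith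

lemma exists_norm_sum_cesaroKernel_le (ha : a ∈ Ioo (0 : ℝ) 1) :
    ∃ C, 0 < C ∧ ∀ n : ℕ, 1 ≤ n → ∀ u ∈ Ioc (0 : ℝ) (Real.pi / n), ∀ k < n,
      ‖∑ i ∈ Finset.Ico k n, cesaroKernel a n (u + i * (Real.pi / n))‖ ≤
        C * n * ((k : ℝ) + 1) ^ (a - 1) := by
  obtain ⟨C, hC, h⟩ := exists_norm_cesaroKernel_grid_le ha
  have h1a : 0 < 1 - a := by linarith [ha.2]
  refine ⟨C * (1 + 2 / (1 - a)), by positivity, fun n hn u hu k hk => ?_⟩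
  obtain ⟨h1, h2⟩ := h n hn u hu
  refine (norm_sum_Ico_le_of_alternating ha (by positivity) h1 h2 hk).trans (le_of_eq ?_)
  ring

end

section

/-! ### Summation by parts -/

/-- Backward differences, with the value `0` before the first term. -/
def backwardDiff (F : ℕ → ℝ) : ℕ → ℝ
  | 0 => F 0
  | k + 1 => F (k + 1) - F k

/-- Mixed backward differences of a double sequence. -/
def mixedDiff (F : ℕ → ℕ → ℝ) (k l : ℕ) : ℝ :=
  backwardDiff (fun k' => backwardDiff (F k') l) k

lemma sum_backwardDiff (F : ℕ → ℝ) (n : ℕ) :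
    ∑ k ∈ Finset.range (n + 1), backwardDiff F k = F n := by
  induction n with
  | zero => simp [backwardDiff]
  | succ n ih => rw [Finset.sum_range_succ, ih, backwardDiff]; ring

/-- Abel summation against tails. The convention that the difference at index `0` is `F 0` removes
the boundary term. -/
lemma sum_mul_eq_sum_backwardDiff_mul (F : ℕ → ℝ) (K : ℕ → ℂ) (n : ℕ) :
    ∑ k ∈ Finset.range n, (F k : ℂ) * K k =
      ∑ k ∈ Finset.range n, (backwardDiff F k : ℂ) * ∑ i ∈ Finset.Ico k n, K i := by
  induction n with
  | zero => simp
  | succ n ih =>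
    have h : ∀ k ∈ Finset.range (n + 1), (backwardDiff F k : ℂ) * ∑ i ∈ Finset.Ico k (n + 1), K i =
        (backwardDiff F k : ℂ) * ∑ i ∈ Finset.Ico k n, K i + (backwardDiff F k : ℂ) * K n := by
      intro k hk
      rw [Finset.sum_Ico_succ_top (by simpa [Nat.lt_succ_iff] using hk), mul_add]
    rw [Finset.sum_congr rfl h, Finset.sum_add_distrib, ← Finset.sum_mul, ← Complex.ofReal_sum,
      sum_backwardDiff, Finset.sum_range_succ, ih, Finset.sum_range_succ _ n]
    simp

lemma sum_sum_mul_eq_sum_sum_mixedDiff_mul (F : ℕ → ℕ → ℝ) (K K' : ℕ → ℂ) (n m : ℕ) :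
    ∑ k ∈ Finset.range n, ∑ l ∈ Finset.range m, (F k l : ℂ) * (K k * K' l) =
      ∑ k ∈ Finset.range n, ∑ l ∈ Finset.range m, (mixedDiff F k l : ℂ) *
        ((∑ i ∈ Finset.Ico k n, K i) * ∑ j ∈ Finset.Ico l m, K' j) := by
  calc _ = ∑ k ∈ Finset.range n, K k * ∑ l ∈ Finset.range m, (F k l : ℂ) * K' l := by
        refine Finset.sum_congr rfl fun k _ => ?_
        rw [Finset.mul_sum]
        exact Finset.sum_congr rfl fun l _ => by ring
    _ = ∑ k ∈ Finset.range n, ∑ l ∈ Finset.range m,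
          (∑ j ∈ Finset.Ico l m, K' j) * ((backwardDiff (F k) l : ℂ) * K k) := by
        refine Finset.sum_congr rfl fun k _ => ?_
        rw [sum_mul_eq_sum_backwardDiff_mul, Finset.mul_sum]
        exact Finset.sum_congr rfl fun l _ => by ring
    _ = ∑ l ∈ Finset.range m, (∑ j ∈ Finset.Ico l m, K' j) *
          ∑ k ∈ Finset.range n, (backwardDiff (F k) l : ℂ) * K k := by
        rw [Finset.sum_comm]
        exact Finset.sum_congr rfl fun l _ => by rw [Finset.mul_sum]
    _ = ∑ l ∈ Finset.range m, ∑ k ∈ Finset.range n, (mixedDiff F k l : ℂ) *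
        ((∑ i ∈ Finset.Ico k n, K i) * ∑ j ∈ Finset.Ico l m, K' j) := by
        refine Finset.sum_congr rfl fun l _ => ?_
        rw [sum_mul_eq_sum_backwardDiff_mul (fun k => backwardDiff (F k) l), Finset.mul_sum]
        exact Finset.sum_congr rfl fun k _ => by rw [mixedDiff]; ring
    _ = _ := Finset.sum_comm

lemma abs_backwardDiff_le (F : ℕ → ℝ) (k : ℕ) : |backwardDiff F k| ≤ |F k| + |F (k - 1)| := by
  cases k with
  | zero => simp [backwardDiff]
  | succ k => exact abs_sub _ _

lemma mixedDiff_swap (F : ℕ → ℕ → ℝ) (k l : ℕ) :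
    mixedDiff F k l = mixedDiff (fun l k => F k l) l k := by
  cases k <;> cases l <;> simp only [mixedDiff, backwardDiff]
  ring

/-- A mixed difference is estimated by differences in the first variable alone. At `l = 0` truncated
subtraction makes both terms on the right equal, and the bound still holds. -/
lemma abs_mixedDiff_le_first (F : ℕ → ℕ → ℝ) {k : ℕ} (hk : 1 ≤ k) (l : ℕ) :
    |mixedDiff F k l| ≤ |F k l - F (k - 1) l| + |F k (l - 1) - F (k - 1) (l - 1)| := by
  obtain ⟨k, rfl⟩ : ∃ j, k = j + 1 := ⟨k - 1, by omega⟩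
  rw [mixedDiff_swap]
  simp only [mixedDiff, backwardDiff, Nat.add_sub_cancel]
  exact abs_backwardDiff_le (fun l => F (k + 1) l - F k l) l

lemma abs_mixedDiff_le {F : ℕ → ℕ → ℝ} {k l : ℕ} {η : ℝ}
    (h : ∀ i ≤ k, ∀ j ≤ l, |F i j| ≤ η) : |mixedDiff F k l| ≤ 4 * η := by
  have h1 := abs_backwardDiff_le (fun k' => backwardDiff (F k') l) k
  have h2 := abs_backwardDiff_le (F k) l
  have h3 := abs_backwardDiff_le (F (k - 1)) l
  have := h k le_rfl l le_rfl
  have := h k le_rfl (l - 1) (Nat.sub_le _ _)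
  have := h (k - 1) (Nat.sub_le _ _) l le_rfl
  have := h (k - 1) (Nat.sub_le _ _) (l - 1) (Nat.sub_le _ _)
  rw [mixedDiff]
  linarith

/-! ### Weights attached to the sequence `lam` -/

/-- The sums `lam 1 / 1 + ⋯ + lam (j + 1) / (j + 1)`. -/
noncomputable def weightSum (lam : ℕ → ℝ) (j : ℕ) : ℝ :=
  ∑ q ∈ Finset.range (j + 1), lam (q + 1) / ((q : ℝ) + 1)

variable {lam : ℕ → ℝ} {γ a : ℝ}

/-- The product is `lam j / j^(1-γ)` times a power of `j` with exponent `1 - γ + e ≤ 0`; both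
factors are nonincreasing. -/
lemma lam_mul_rpow_antitone (hpos : ∀ k, 1 ≤ k → 0 < lam k)
    (hanti : AntitoneOn (fun k : ℕ => lam k / (k : ℝ) ^ (1 - γ)) (Ici 1))
    {e : ℝ} (he : e ≤ γ - 1) {p r : ℕ} (hpr : p ≤ r) :
    lam (r + 1) * ((r : ℝ) + 1) ^ e ≤ lam (p + 1) * ((p : ℝ) + 1) ^ e := by
  have key : ∀ j : ℕ, lam (j + 1) * ((j : ℝ) + 1) ^ e =
      lam (j + 1) / ((j + 1 : ℕ) : ℝ) ^ (1 - γ) * ((j : ℝ) + 1) ^ (1 - γ + e) := by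
    intro j
    have hj : (0 : ℝ) < (j : ℝ) + 1 := by positivity
    rw [Real.rpow_add hj]
    push_cast
    field_simp
  rw [key, key]
  have h1 := hanti (show p + 1 ∈ Ici 1 by simp) (show r + 1 ∈ Ici 1 by simp) (by omega)
  have h2 : ((r : ℝ) + 1) ^ (1 - γ + e) ≤ ((p : ℝ) + 1) ^ (1 - γ + e) := by
    refine Real.rpow_le_rpow_of_nonpos (by positivity) ?_ (by linarith)
    have : (p : ℝ) ≤ r := by exact_mod_cast hpr
    linarith
  have := hpos (p + 1) (by omega)
  exact mul_le_mul h1 h2 (by positivity) (by positivity)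

lemma weightSum_nonneg (hpos : ∀ k, 1 ≤ k → 0 < lam k) (j : ℕ) : 0 ≤ weightSum lam j :=
  Finset.sum_nonneg fun q _ => div_nonneg (hpos _ (by omega)).le (by positivity)

lemma weightSum_mono (hpos : ∀ k, 1 ≤ k → 0 < lam k) : Monotone (weightSum lam) := by
  refine monotone_nat_of_le_succ fun j => ?_
  unfold weightSum
  rw [Finset.sum_range_succ _ (j + 1)]
  have : 0 ≤ lam (j + 1 + 1) / (((j + 1 : ℕ) : ℝ) + 1) :=
    div_nonneg (hpos _ (by omega)).le (by positivity)
  linarith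

/-- Since `lam j / j` is nonincreasing, each of the `r + 1` summands is at least the last one. -/
lemma lam_le_weightSum (hγ : 0 ≤ γ) (hpos : ∀ k, 1 ≤ k → 0 < lam k)
    (hanti : AntitoneOn (fun k : ℕ => lam k / (k : ℝ) ^ (1 - γ)) (Ici 1)) (r : ℕ) :
    lam (r + 1) ≤ weightSum lam r := by
  have h : ∀ q ∈ Finset.range (r + 1), lam (r + 1) / ((r : ℝ) + 1) ≤ lam (q + 1) / ((q : ℝ) + 1) := by
    intro q hq
    have := lam_mul_rpow_antitone hpos hanti (e := -1) (by linarith)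
      (show q ≤ r by simpa [Nat.lt_succ_iff] using hq)
    simpa only [Real.rpow_neg_one, ← div_eq_mul_inv] using this
  have := Finset.card_nsmul_le_sum _ _ _ h
  rw [Finset.card_range, nsmul_eq_mul] at this
  refine le_trans (le_of_eq ?_) this
  push_cast
  field_simp

/-- After rearrangement, the increment in position `r` carries the weight `(p+r+1)^(a-1)` but is
divided by `lam (r + 1)` in the variation; this bounds the discrepancy uniformly in `r`. For `r ≤ p`
the weight sum grows, and for `r ≥ p` the product `lam j * j^(a-1)` decreases. -/
lemma lam_mul_rpow_le_weightSum (ha : 0 ≤ a) (ha1 : a ≤ 1) (haγ : a ≤ γ)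
    (hpos : ∀ k, 1 ≤ k → 0 < lam k)
    (hanti : AntitoneOn (fun k : ℕ => lam k / (k : ℝ) ^ (1 - γ)) (Ici 1)) (p r : ℕ) :
    lam (r + 1) * ((p + r : ℕ) + 1 : ℝ) ^ (a - 1) ≤ weightSum lam p * ((p : ℝ) + 1) ^ (a - 1) := by
  have hγ : 0 ≤ γ := ha.trans haγ
  have hr := hpos (r + 1) (by omega)
  rcases le_total r p with h | h
  · have h1 : lam (r + 1) ≤ weightSum lam p :=
      (lam_le_weightSum hγ hpos hanti r).trans (weightSum_mono hpos h)
    refine mul_le_mul h1 ?_ (by positivity) (weightSum_nonneg hpos p)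
    refine Real.rpow_le_rpow_of_nonpos (by positivity) ?_ (by linarith)
    push_cast
    linarith [show (0 : ℝ) ≤ r by positivity]
  · calc lam (r + 1) * ((p + r : ℕ) + 1 : ℝ) ^ (a - 1) ≤ lam (r + 1) * ((r : ℝ) + 1) ^ (a - 1) := by
          refine mul_le_mul_of_nonneg_left ?_ hr.le
          refine Real.rpow_le_rpow_of_nonpos (by positivity) ?_ (by linarith)
          push_cast
          linarith [show (0 : ℝ) ≤ p by positivity]
      _ ≤ lam (p + 1) * ((p : ℝ) + 1) ^ (a - 1) :=
          lam_mul_rpow_antitone hpos hanti (by linarith) h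
      _ ≤ _ := mul_le_mul_of_nonneg_right (lam_le_weightSum hγ hpos hanti p) (by positivity)

/-- The `Λ`-variation bound, for all orderings, controls the weighted sums of the increments. -/
lemma sum_Ico_mul_rpow_le (ha : 0 ≤ a) (ha1 : a ≤ 1) (haγ : a ≤ γ)
    (hpos : ∀ k, 1 ≤ k → 0 < lam k)
    (hanti : AntitoneOn (fun k : ℕ => lam k / (k : ℝ) ^ (1 - γ)) (Ici 1))
    {d : ℕ → ℝ} (hd : ∀ k, 0 ≤ d k) {p n : ℕ} {V : ℝ}
    (hV : ∀ (N : ℕ) (τ : Fin N → ℕ), Function.Injective τ → (∀ i, p ≤ τ i ∧ τ i < n) →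
      ∑ i, d (τ i) / lam ((i : ℕ) + 1) ≤ V) :
    ∑ k ∈ Finset.Ico p n, d k * ((k : ℝ) + 1) ^ (a - 1) ≤
      V * (weightSum lam p * ((p : ℝ) + 1) ^ (a - 1)) := by
  set N := n - p
  set D : Fin N → ℝ := fun i => d (p + i)
  set w : Fin N → ℝ := fun i => ((p + i : ℕ) + 1 : ℝ) ^ (a - 1)
  -- Put the increments in decreasing order. The weights already decrease, so pairing them with the
  -- sorted increments can only enlarge the sum.
  set σ := Tuple.sort (fun i => -D i)
  have hw : Antitone w := by
    intro i j hij
    refine Real.rpow_le_rpow_of_nonpos (by positivity) ?_ (by linarith)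
    have : ((p + i : ℕ) : ℝ) ≤ (p + j : ℕ) := by exact_mod_cast Nat.add_le_add_left hij p
    linarith
  have hD : Antitone (D ∘ σ) := by
    intro i j hij
    have := Tuple.monotone_sort (fun i => -D i) hij
    simpa using this
  calc ∑ k ∈ Finset.Ico p n, d k * ((k : ℝ) + 1) ^ (a - 1)
      = ∑ i, D i * w i := by
        rw [Finset.sum_Ico_eq_sum_range,
          ← Fin.sum_univ_eq_sum_range (fun i => d (p + i) * (((p + i : ℕ) : ℝ) + 1) ^ (a - 1))]
    _ = ∑ i, D (σ i) * w (σ i) := (Equiv.sum_comp σ (fun i => D i * w i)).symm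
    _ ≤ ∑ i, D (σ i) * w i := (hD.monovary hw).sum_mul_comp_perm_le_sum_mul (σ := σ)
    _ ≤ ∑ i : Fin N, D (σ i) / lam ((i : ℕ) + 1) *
          (weightSum lam p * ((p : ℝ) + 1) ^ (a - 1)) := by
        refine Finset.sum_le_sum fun i _ => ?_
        have hl := hpos ((i : ℕ) + 1) (by omega)
        rw [div_mul_eq_mul_div, le_div_iff₀ hl, mul_assoc]
        refine mul_le_mul_of_nonneg_left ?_ (hd _)
        rw [mul_comm]
        exact lam_mul_rpow_le_weightSum ha ha1 haγ hpos hanti p i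
    _ = (∑ i : Fin N, D (σ i) / lam ((i : ℕ) + 1)) *
          (weightSum lam p * ((p : ℝ) + 1) ^ (a - 1)) := by rw [Finset.sum_mul]
    _ ≤ _ := by
        refine mul_le_mul_of_nonneg_right ?_
          (mul_nonneg (weightSum_nonneg hpos p) (by positivity))
        refine hV N (fun i => p + (σ i : ℕ)) ?_ ?_
        · intro i j hij
          exact σ.injective (Fin.ext (by simpa using hij))
        · intro i
          have := (σ i).2
          omega

/-- Interchange the summations: the sum of `(j+1)^(γ-2)` over `j ≥ q` is of order `(q+1)^(γ-1)`,
which leaves the series of the hypothesis. -/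
lemma summable_weightSum_mul_rpow (hγ : 0 ≤ γ) (hγ1 : γ < 1) (hpos : ∀ k, 1 ≤ k → 0 < lam k)
    (hsum : Summable fun k : ℕ => lam (k + 1) / ((k + 1 : ℕ) : ℝ) ^ (2 - γ)) :
    Summable fun j : ℕ => weightSum lam j * ((j : ℝ) + 1) ^ (γ - 2) := by
  have h1γ : 0 < 1 - γ := by linarith
  refine summable_of_sum_range_le (c := 4 / (1 - γ) *
    ∑' k : ℕ, lam (k + 1) / ((k + 1 : ℕ) : ℝ) ^ (2 - γ))
    (fun j => mul_nonneg (weightSum_nonneg hpos j) (by positivity)) fun N => ?_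
  have hl : ∀ q : ℕ, 0 < lam (q + 1) := fun q => hpos _ (by omega)
  calc ∑ j ∈ Finset.range N, weightSum lam j * ((j : ℝ) + 1) ^ (γ - 2)
      = ∑ j ∈ Finset.range N, ∑ q ∈ Finset.range (j + 1),
          lam (q + 1) / ((q : ℝ) + 1) * ((j : ℝ) + 1) ^ (γ - 2) := by
        simp only [weightSum, Finset.sum_mul]
    _ = ∑ q ∈ Finset.range N, ∑ j ∈ Finset.Ico q N,
          lam (q + 1) / ((q : ℝ) + 1) * ((j : ℝ) + 1) ^ (γ - 2) := by
        refine Finset.sum_comm' fun j q => ?_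
        simp only [Finset.mem_range, Finset.mem_Ico]
        omega
    _ ≤ ∑ q ∈ Finset.range N, 4 / (1 - γ) * (lam (q + 1) / ((q + 1 : ℕ) : ℝ) ^ (2 - γ)) := by
        refine Finset.sum_le_sum fun q _ => ?_
        rw [← Finset.mul_sum]
        have hq : (0 : ℝ) < (q : ℝ) + 1 := by positivity
        have := hl q
        calc _ ≤ lam (q + 1) / ((q : ℝ) + 1) * (4 / (1 - γ) * ((q : ℝ) + 1) ^ (γ - 1)) :=
              mul_le_mul_of_nonneg_left (sum_Ico_rpow_sub_two_le hγ hγ1 q N) (by positivity)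
          _ = _ := by
              have e : ((q : ℝ) + 1) ^ (2 - γ) = ((q : ℝ) + 1) * (((q : ℝ) + 1) ^ (γ - 1))⁻¹ := by
                rw [← Real.rpow_neg hq.le, ← Real.rpow_one_add' hq.le (by linarith)]
                congr 1; ring
              push_cast
              rw [e]
              field_simp
    _ ≤ _ := by
        rw [← Finset.mul_sum]
        refine mul_le_mul_of_nonneg_left ?_ (by positivity)
        exact hsum.sum_le_tsum _ fun q _ => by have := hl q; positivity

lemma exists_sum_Ico_weightSum_le (hγ : 0 ≤ γ) (hγ1 : γ < 1) (hpos : ∀ k, 1 ≤ k → 0 < lam k)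
    (hsum : Summable fun k : ℕ => lam (k + 1) / ((k + 1 : ℕ) : ℝ) ^ (2 - γ)) {ε : ℝ} (hε : 0 < ε) :
    ∃ P : ℕ, 1 ≤ P ∧ (∀ m, ∑ j ∈ Finset.Ico P m, weightSum lam j * ((j : ℝ) + 1) ^ (γ - 2) ≤ ε) ∧
      weightSum lam P * ((P : ℝ) + 1) ^ (γ - 1) ≤ ε := by
  have hs := summable_weightSum_mul_rpow hγ hγ1 hpos hsum
  set θ : ℕ → ℝ := fun j => weightSum lam j * ((j : ℝ) + 1) ^ (γ - 2) with hθ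
  have hθ0 : ∀ j, 0 ≤ θ j := fun j => mul_nonneg (weightSum_nonneg hpos j) (by positivity)
  have ht := tendsto_sum_nat_add θ
  obtain ⟨P, hP, hP1⟩ := ((ht.eventually (gt_mem_nhds (show 0 < ε / 4 by positivity))).and
    (eventually_ge_atTop 1)).exists
  have key : ∀ m, ∑ j ∈ Finset.Ico P m, θ j ≤ ε / 4 := by
    intro m
    rw [Finset.sum_Ico_eq_sum_range]
    refine le_trans ?_ hP.le
    simp only [add_comm P]
    exact ((summable_nat_add_iff P).2 hs).sum_le_tsum _ fun j _ => hθ0 _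
  refine ⟨P, hP1, fun m => (key m).trans (by linarith), ?_⟩
  have h1 := key (2 * P + 1)
  -- The bound at `P` itself comes from the `P + 1` indices in `[P, 2P]`. There `weightSum` is at
  -- least its value at `P` and the power loses at most a factor 4, hence the choice of `ε / 4`
  -- above.
  have h2 : ∀ j ∈ Finset.Ico P (2 * P + 1),
      weightSum lam P * ((1 / 4) * ((P : ℝ) + 1) ^ (γ - 2)) ≤ θ j := by
    intro j hj
    rw [Finset.mem_Ico] at hj
    refine mul_le_mul (weightSum_mono hpos hj.1) ?_ (by positivity) (weightSum_nonneg hpos j)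
    have h3 : (2 * ((P : ℝ) + 1)) ^ (γ - 2) ≤ ((j : ℝ) + 1) ^ (γ - 2) := by
      refine Real.rpow_le_rpow_of_nonpos (by positivity) ?_ (by linarith)
      have : (j : ℝ) + 1 ≤ 2 * P + 1 := by exact_mod_cast hj.2
      linarith
    rw [Real.mul_rpow (by norm_num) (by positivity)] at h3
    refine le_trans (mul_le_mul_of_nonneg_right ?_ (by positivity)) h3
    have : (2 : ℝ) ^ (-2 : ℝ) ≤ 2 ^ (γ - 2) :=
      Real.rpow_le_rpow_of_exponent_le (by norm_num) (by linarith)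
    refine le_trans (le_of_eq ?_) this
    rw [Real.rpow_neg (by norm_num)]; norm_num
  have h3 := Finset.card_nsmul_le_sum _ _ _ h2
  rw [Nat.card_Ico, nsmul_eq_mul, show 2 * P + 1 - P = P + 1 by omega] at h3
  have e : ((P : ℝ) + 1) ^ (γ - 1) = ((P : ℝ) + 1) ^ (γ - 2) * ((P : ℝ) + 1) := by
    rw [← Real.rpow_add_one (by positivity)]; congr 1; ring
  rw [e]
  push_cast at h3
  linarith

/-! ### The double sum -/

/-- Below `P` the weight factor is constant and the powers sum to order `P^b / b`; from `P` on the
two powers combine into the convergent series. -/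
lemma sum_rpow_mul_weightSum_max_le {b : ℝ} (hb : 0 < b) (hb1 : b ≤ 1)
    (hpos : ∀ k, 1 ≤ k → 0 < lam k) {P : ℕ} {ε : ℝ}
    (h1 : ∀ m, ∑ j ∈ Finset.Ico P m, weightSum lam j * ((j : ℝ) + 1) ^ (a + b - 2) ≤ ε)
    (h2 : weightSum lam P * ((P : ℝ) + 1) ^ (a + b - 1) ≤ ε) (m : ℕ) :
    ∑ l ∈ Finset.range m, ((l : ℝ) + 1) ^ (b - 1) *
      (weightSum lam (max l P) * (((max l P : ℕ) : ℝ) + 1) ^ (a - 1)) ≤ (1 / b + 1) * ε := by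
  have hW := weightSum_nonneg hpos
  have hP0 : (0 : ℝ) < (P : ℝ) + 1 := by positivity
  have hnn : ∀ l : ℕ, 0 ≤ ((l : ℝ) + 1) ^ (b - 1) *
      (weightSum lam (max l P) * (((max l P : ℕ) : ℝ) + 1) ^ (a - 1)) := fun l =>
    mul_nonneg (by positivity) (mul_nonneg (hW _) (by positivity))
  have hfirst : ∑ l ∈ Finset.range P, ((l : ℝ) + 1) ^ (b - 1) *
      (weightSum lam (max l P) * (((max l P : ℕ) : ℝ) + 1) ^ (a - 1)) ≤ 1 / b * ε := by
    calc _ = (∑ l ∈ Finset.range P, ((l : ℝ) + 1) ^ (b - 1)) *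
          (weightSum lam P * ((P : ℝ) + 1) ^ (a - 1)) := by
          rw [Finset.sum_mul]
          refine Finset.sum_congr rfl fun l hl => ?_
          rw [max_eq_right (Finset.mem_range.1 hl).le]
      _ ≤ ((P : ℝ) + 1) ^ b / b * (weightSum lam P * ((P : ℝ) + 1) ^ (a - 1)) := by
          refine mul_le_mul_of_nonneg_right ?_ (mul_nonneg (hW _) (by positivity))
          refine (sum_range_rpow_sub_one_le hb hb1 P).trans ?_
          gcongr
          linarith
      _ = 1 / b * (weightSum lam P * ((P : ℝ) + 1) ^ (a + b - 1)) := by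
          rw [show a + b - 1 = b + (a - 1) by ring, Real.rpow_add hP0]
          ring
      _ ≤ _ := by gcongr
  -- Ending at `P + m` instead of `m` avoids distinguishing whether `m` exceeds `P`.
  have hsecond : ∑ l ∈ Finset.Ico P (P + m), ((l : ℝ) + 1) ^ (b - 1) *
      (weightSum lam (max l P) * (((max l P : ℕ) : ℝ) + 1) ^ (a - 1)) ≤ ε := by
    refine le_trans (le_of_eq ?_) (h1 (P + m))
    refine Finset.sum_congr rfl fun l hl => ?_
    rw [max_eq_left (Finset.mem_Ico.1 hl).1,
      show a + b - 2 = (b - 1) + (a - 1) by ring, Real.rpow_add (by positivity)]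
    ring
  calc _ ≤ ∑ l ∈ Finset.range (P + m), ((l : ℝ) + 1) ^ (b - 1) *
      (weightSum lam (max l P) * (((max l P : ℕ) : ℝ) + 1) ^ (a - 1)) :=
        Finset.sum_le_sum_of_subset_of_nonneg (Finset.range_subset_range.2 (by omega))
          fun l _ _ => hnn l
    _ ≤ _ := by
        rw [← Finset.sum_range_add_sum_Ico _ (Nat.le_add_right P m)]
        linarith

/-- The region where the first index dominates. The rows `l` and `l - 1` each contribute the
one-variable bound starting from `max l P`, whence the factor 2. -/
lemma sum_range_sum_Ico_abs_mixedDiff_le {b : ℝ} (hb : 0 < b) (hb1 : b ≤ 1)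
    (hpos : ∀ k, 1 ≤ k → 0 < lam k) {P : ℕ} (hP : 1 ≤ P) {ε : ℝ}
    (h1 : ∀ m, ∑ j ∈ Finset.Ico P m, weightSum lam j * ((j : ℝ) + 1) ^ (a + b - 2) ≤ ε)
    (h2 : weightSum lam P * ((P : ℝ) + 1) ^ (a + b - 1) ≤ ε)
    {F : ℕ → ℕ → ℝ} {n m : ℕ} {V : ℝ} (hV0 : 0 ≤ V)
    (hV : ∀ l < m, ∀ p, 1 ≤ p → ∑ k ∈ Finset.Ico p n, |F k l - F (k - 1) l| *
      ((k : ℝ) + 1) ^ (a - 1) ≤ V * (weightSum lam p * ((p : ℝ) + 1) ^ (a - 1))) :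
    ∑ l ∈ Finset.range m, ∑ k ∈ Finset.Ico (max l P) n,
      |mixedDiff F k l| * (((k : ℝ) + 1) ^ (a - 1) * ((l : ℝ) + 1) ^ (b - 1)) ≤
        2 * V * ((1 / b + 1) * ε) := by
  refine le_trans (Finset.sum_le_sum fun l hl => ?_) (le_trans (le_of_eq (Finset.mul_sum _ _
    (2 * V)).symm) (mul_le_mul_of_nonneg_left
      (sum_rpow_mul_weightSum_max_le hb hb1 hpos h1 h2 m) (by positivity)))
  have hl' := Finset.mem_range.1 hl
  have hp : 1 ≤ max l P := hP.trans (le_max_right _ _)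
  calc _ ≤ ∑ k ∈ Finset.Ico (max l P) n, (|F k l - F (k - 1) l| * ((k : ℝ) + 1) ^ (a - 1) +
        |F k (l - 1) - F (k - 1) (l - 1)| * ((k : ℝ) + 1) ^ (a - 1)) * ((l : ℝ) + 1) ^ (b - 1) := by
        refine Finset.sum_le_sum fun k hk => ?_
        rw [← mul_assoc, ← add_mul]
        have := abs_mixedDiff_le_first F (hp.trans (Finset.mem_Ico.1 hk).1) l
        gcongr
    _ ≤ (V * (weightSum lam (max l P) * (((max l P : ℕ) : ℝ) + 1) ^ (a - 1)) +
        V * (weightSum lam (max l P) * (((max l P : ℕ) : ℝ) + 1) ^ (a - 1))) *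
          ((l : ℝ) + 1) ^ (b - 1) := by
        rw [← Finset.sum_mul, Finset.sum_add_distrib]
        exact mul_le_mul_of_nonneg_right
          (add_le_add (hV l hl' _ hp) (hV (l - 1) (by omega) _ hp)) (by positivity)
    _ = _ := by ring

lemma exists_sum_abs_mixedDiff_le {α β : ℝ} (hα : α ∈ Ioo (0 : ℝ) 1) (hβ : β ∈ Ioo (0 : ℝ) 1)
    (hαβ : α + β < 1) (hpos : ∀ k, 1 ≤ k → 0 < lam k)
    (hsum : Summable fun k : ℕ => lam (k + 1) / ((k + 1 : ℕ) : ℝ) ^ (2 - (α + β)))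
    {ε : ℝ} (hε : 0 < ε) :
    ∃ P : ℕ, 1 ≤ P ∧ ∀ (F : ℕ → ℕ → ℝ) (n m : ℕ) (V η : ℝ), 0 ≤ V → 0 ≤ η →
      (∀ l < m, ∀ p, 1 ≤ p → ∑ k ∈ Finset.Ico p n, |F k l - F (k - 1) l| *
        ((k : ℝ) + 1) ^ (α - 1) ≤ V * (weightSum lam p * ((p : ℝ) + 1) ^ (α - 1))) →
      (∀ k < n, ∀ p, 1 ≤ p → ∑ l ∈ Finset.Ico p m, |F k l - F k (l - 1)| *
        ((l : ℝ) + 1) ^ (β - 1) ≤ V * (weightSum lam p * ((p : ℝ) + 1) ^ (β - 1))) →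
      (∀ k < P, ∀ l < P, |F k l| ≤ η) →
      ∑ k ∈ Finset.range n, ∑ l ∈ Finset.range m,
        |mixedDiff F k l| * (((k : ℝ) + 1) ^ (α - 1) * ((l : ℝ) + 1) ^ (β - 1)) ≤
          4 * P ^ 2 * η + V * ε := by
  have hα0 := hα.1
  have hβ0 := hβ.1
  set c : ℝ := 2 * (1 / β + 1) + 2 * (1 / α + 1) with hc
  have hc0 : 0 < c := by positivity
  obtain ⟨P, hP, h1, h2⟩ := exists_sum_Ico_weightSum_le (γ := α + β) (by linarith) hαβ hpos hsum
    (div_pos hε hc0)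
  refine ⟨P, hP, fun F n m V η hV hη hrow hcol hsmall => ?_⟩
  have b1 := sum_range_sum_Ico_abs_mixedDiff_le hβ.1 hβ.2.le hpos hP h1 h2 hV hrow
  have b2 := sum_range_sum_Ico_abs_mixedDiff_le (F := fun l k => F k l) (a := β) (b := α)
    (n := m) (m := n) hα.1 hα.2.le hpos hP (by simpa only [add_comm β α] using h1)
    (by simpa only [add_comm β α] using h2) hV hcol
  set t : ℕ → ℕ → ℝ := fun k l =>
    |mixedDiff F k l| * (((k : ℝ) + 1) ^ (α - 1) * ((l : ℝ) + 1) ^ (β - 1)) with ht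
  have ht0 : ∀ k l, 0 ≤ t k l := fun k l => by positivity
  have b2' : ∑ k ∈ Finset.range n, ∑ l ∈ Finset.Ico (max k P) m, t k l ≤
      2 * V * ((1 / α + 1) * (ε / c)) := by
    refine le_trans (le_of_eq ?_) b2
    refine Finset.sum_congr rfl fun k _ => Finset.sum_congr rfl fun l _ => ?_
    rw [ht, ← mixedDiff_swap]
    ring
  have b3 : ∑ k ∈ Finset.range P, ∑ l ∈ Finset.range P, t k l ≤ 4 * P ^ 2 * η := by
    calc _ ≤ ∑ k ∈ Finset.range P, ∑ l ∈ Finset.range P, 4 * η := by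
          refine Finset.sum_le_sum fun k hk => Finset.sum_le_sum fun l hl => ?_
          rw [Finset.mem_range] at hk hl
          have h3 : |mixedDiff F k l| ≤ 4 * η :=
            abs_mixedDiff_le fun i hi j hj => hsmall i (by omega) j (by omega)
          have h4 : ((k : ℝ) + 1) ^ (α - 1) ≤ 1 :=
            Real.rpow_le_one_of_one_le_of_nonpos (by linarith [show (0 : ℝ) ≤ k by positivity])
              (by linarith [hα.2])
          have h5 : ((l : ℝ) + 1) ^ (β - 1) ≤ 1 :=
            Real.rpow_le_one_of_one_le_of_nonpos (by linarith [show (0 : ℝ) ≤ l by positivity])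
              (by linarith [hβ.2])
          calc t k l ≤ 4 * η * (1 * 1) := by
                refine mul_le_mul h3 ?_ (by positivity) (by positivity)
                exact mul_le_mul h4 h5 (by positivity) (by norm_num)
            _ = 4 * η := by ring
      _ = _ := by simp; ring
  have hIco : ∀ p q : ℕ, Finset.Ico p q = (Finset.range q).filter (p ≤ ·) := by
    intro p q; ext i; simp only [Finset.mem_Ico, Finset.mem_filter, Finset.mem_range]; tauto
  -- A pair outside the block `k, l < P` has its larger index at least `P`, so it lies in one of the
  -- two dominated regions. The diagonal is counted twice, harmlessly, since all terms are
  -- nonnegative.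
  have hcover : ∑ k ∈ Finset.range n, ∑ l ∈ Finset.range m, t k l ≤
      ∑ l ∈ Finset.range m, ∑ k ∈ Finset.Ico (max l P) n, t k l +
      ∑ k ∈ Finset.range n, ∑ l ∈ Finset.Ico (max k P) m, t k l +
      ∑ k ∈ Finset.range P, ∑ l ∈ Finset.range P, t k l := by
    have e1 : ∑ l ∈ Finset.range m, ∑ k ∈ Finset.Ico (max l P) n, t k l =
        ∑ k ∈ Finset.range n, ∑ l ∈ Finset.range m, if max l P ≤ k then t k l else 0 := by
      rw [Finset.sum_comm]
      refine Finset.sum_congr rfl fun l _ => ?_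
      rw [hIco, Finset.sum_filter]
    have e2 : ∑ k ∈ Finset.range n, ∑ l ∈ Finset.Ico (max k P) m, t k l =
        ∑ k ∈ Finset.range n, ∑ l ∈ Finset.range m, if max k P ≤ l then t k l else 0 := by
      refine Finset.sum_congr rfl fun k _ => ?_
      rw [hIco, Finset.sum_filter]
    have e3 : ∑ k ∈ Finset.range n, ∑ l ∈ Finset.range m, (if k < P ∧ l < P then t k l else 0) ≤
        ∑ k ∈ Finset.range P, ∑ l ∈ Finset.range P, t k l := by
      rw [← Finset.sum_product', ← Finset.sum_product', ← Finset.sum_filter]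
      refine Finset.sum_le_sum_of_subset_of_nonneg ?_ fun _ _ _ => ht0 _ _
      intro x hx
      simp only [Finset.mem_filter, Finset.mem_product, Finset.mem_range] at hx ⊢
      exact hx.2
    refine le_trans ?_ (add_le_add (add_le_add e1.ge e2.ge) e3)
    rw [← Finset.sum_add_distrib, ← Finset.sum_add_distrib]
    refine Finset.sum_le_sum fun k _ => ?_
    rw [← Finset.sum_add_distrib, ← Finset.sum_add_distrib]
    refine Finset.sum_le_sum fun l _ => ?_
    have h0 := ht0 k l
    by_cases c1 : max l P ≤ k
    · rw [if_pos c1]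
      have : 0 ≤ if max k P ≤ l then t k l else 0 := by split_ifs <;> simp [h0]
      have : 0 ≤ if k < P ∧ l < P then t k l else 0 := by split_ifs <;> simp [h0]
      linarith
    · rw [if_neg c1]
      by_cases c2 : max k P ≤ l
      · rw [if_pos c2]
        have : 0 ≤ if k < P ∧ l < P then t k l else 0 := by split_ifs <;> simp [h0]
        linarith
      · rw [if_neg c2, if_pos]
        · simp
        · rw [max_le_iff] at c1 c2; omega
  calc _ ≤ _ := hcover
    _ ≤ 2 * V * ((1 / β + 1) * (ε / c)) + 2 * V * ((1 / α + 1) * (ε / c)) + 4 * P ^ 2 * η :=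
        add_le_add (add_le_add b1 b2') b3
    _ = V * (c * (ε / c)) + 4 * P ^ 2 * η := by rw [hc]; ring
    _ = _ := by rw [mul_div_cancel₀ _ hc0.ne']; ring

end

section

/-! ### Variation of periodic functions over translated windows -/

variable {lam : ℕ → ℝ} {g : ℝ → ℝ} {V : ℝ}

lemma sum_abs_div_le_of_lambdaVar_le (hpos : ∀ k, 1 ≤ k → 0 < lam k) (hV0 : 0 ≤ V)
    (hV : lambdaVar lam g ≤ ENNReal.ofReal V) {N : ℕ} {a b : Fin N → ℝ}
    (hab : ∀ i, 0 ≤ a i ∧ a i < b i ∧ b i ≤ 2 * Real.pi)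
    (hdis : Pairwise fun i j => b i ≤ a j ∨ b j ≤ a i) :
    ∑ i, |g (b i) - g (a i)| / lam ((i : ℕ) + 1) ≤ V := by
  have hno : Nonoverlapping a b := by
    refine ⟨hab, fun i j hij => ?_⟩
    change Disjoint (Ioo (a i) (b i)) (Ioo (a j) (b j))
    rw [Set.Ioo_disjoint_Ioo, min_le_iff, le_max_iff, le_max_iff]
    have : b i ≤ a j ∨ b j ≤ a i := hdis hij
    tauto
  have h1 : ∑ i : Fin N, ENNReal.ofReal (|g (b i) - g (a i)| / lam ((i : ℕ) + 1)) ≤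
      lambdaVar lam g :=
    le_iSup_of_le N (le_iSup_of_le a (le_iSup_of_le b (le_iSup_of_le hno le_rfl)))
  rw [← ENNReal.ofReal_sum_of_nonneg] at h1
  · exact (ENNReal.ofReal_le_ofReal_iff hV0).1 (h1.trans hV)
  · intro i _
    have := hpos ((i : ℕ) + 1) (by omega)
    positivity

/-- Once `c` is in `[0, 2π)`, the window meets the multiples of the period in its interior only at
`2π`, if at all. Two families in `[0, 2π]` are used, both with the original indexing, so that the
divisors `lam (i + 1)` are unchanged. Intervals on one side of `2π` appear whole in both, shifted
back if they lie beyond. An interval straddling `2π` gives its left piece to one family and its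
right piece to the other. This costs the factor 2. -/
lemma sum_abs_div_le_of_window (hpos : ∀ k, 1 ≤ k → 0 < lam k) (hV0 : 0 ≤ V)
    (hV : lambdaVar lam g ≤ ENNReal.ofReal V) (hg : Function.Periodic g (2 * Real.pi)) (c : ℝ)
    {N : ℕ} {a b : Fin N → ℝ} (hab : ∀ i, c ≤ a i ∧ a i < b i ∧ b i ≤ c + 2 * Real.pi)
    (hdis : Pairwise fun i j => b i ≤ a j ∨ b j ≤ a i) :
    ∑ i, |g (b i) - g (a i)| / lam ((i : ℕ) + 1) ≤ 2 * V := by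
  have hπ := Real.pi_pos
  wlog hc : c ∈ Ico 0 (2 * Real.pi) generalizing c a b
  · obtain ⟨z, hz, -⟩ := existsUnique_add_zsmul_mem_Ico (show 0 < 2 * Real.pi by positivity) c 0
    rw [zero_add] at hz
    have := this (c + z • (2 * Real.pi)) (a := fun i => a i + z • (2 * Real.pi))
      (b := fun i => b i + z • (2 * Real.pi))
      (fun i => ⟨by linarith [(hab i).1], by linarith [(hab i).2.1], by linarith [(hab i).2.2]⟩)
      (fun i j hij => by simpa using hdis hij) hz
    simpa only [hg.zsmul z _] using this
  set T := 2 * Real.pi with hT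
  have h1 := sum_abs_div_le_of_lambdaVar_le hpos hV0 hV
    (a := fun i => if T ≤ a i then a i - T else a i)
    (b := fun i => if T ≤ a i then b i - T else min (b i) T)
    (fun i => by
      obtain ⟨p, q, r⟩ := hab i
      have := hc.1
      have := hc.2
      split_ifs with h
      · exact ⟨by linarith, by linarith, by linarith⟩
      · exact ⟨by linarith, lt_min q (not_le.1 h), min_le_right _ _⟩)
    (fun i j hij => by
      obtain ⟨p, q, r⟩ := hab i
      obtain ⟨p', q', r'⟩ := hab j
      have := hc.1
      have := hc.2
      split_ifs with h h' h'
      · rcases hdis hij with h | h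
        · left; linarith
        · right; linarith
      · left; linarith
      · right; linarith
      · rcases hdis hij with h | h
        · left; exact (min_le_left _ _).trans h
        · right; exact (min_le_left _ _).trans h)
  have h2 := sum_abs_div_le_of_lambdaVar_le hpos hV0 hV
    (a := fun i => if b i ≤ T then a i else max (a i - T) 0)
    (b := fun i => if b i ≤ T then b i else b i - T)
    (fun i => by
      obtain ⟨p, q, r⟩ := hab i
      have := hc.1
      have := hc.2
      split_ifs with h
      · exact ⟨by linarith, by linarith, by linarith⟩
      · exact ⟨le_max_right _ _, max_lt (by linarith) (by linarith), by linarith⟩)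
    (fun i j hij => by
      obtain ⟨p, q, r⟩ := hab i
      obtain ⟨p', q', r'⟩ := hab j
      have := hc.1
      have := hc.2
      split_ifs with h h' h'
      · exact hdis hij
      · right; linarith
      · left; linarith
      · rcases hdis hij with h | h
        · left; exact le_max_of_le_left (by linarith)
        · right; exact le_max_of_le_left (by linarith))
  calc _ ≤ _ := ?_
    _ ≤ V + V := add_le_add h1 h2
    _ = 2 * V := by ring
  rw [← Finset.sum_add_distrib]
  refine Finset.sum_le_sum fun i _ => ?_
  have hl := hpos ((i : ℕ) + 1) (by omega)
  rw [← add_div, div_le_div_iff_of_pos_right hl]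
  by_cases hi : T ≤ a i
  · rw [if_pos hi, if_pos hi, hg.sub_eq, hg.sub_eq]
    linarith [abs_nonneg (g (if b i ≤ T then b i else b i - T) -
      g (if b i ≤ T then a i else max (a i - T) 0))]
  · rw [if_neg hi, if_neg hi]
    by_cases hi' : b i ≤ T
    · rw [min_eq_left hi']
      linarith [abs_nonneg (g (if b i ≤ T then b i else b i - T) -
        g (if b i ≤ T then a i else max (a i - T) 0))]
    · rw [if_neg hi', if_neg hi', min_eq_right (not_le.1 hi').le,
        max_eq_right (by linarith [not_le.1 hi]), hg.sub_eq]
      have : g T = g 0 := by simpa using hg 0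
      rw [this]
      calc |g (b i) - g (a i)| = |(g 0 - g (a i)) + (g (b i) - g 0)| := by congr 1; ring
        _ ≤ _ := abs_add_le _ _

/-- Cells between consecutive grid points do not overlap and lie within `π` of `x`, hence in a
window of length `2π` on the chosen side of `x`. -/
lemma sum_abs_div_le_of_grid (hpos : ∀ k, 1 ≤ k → 0 < lam k) (hV0 : 0 ≤ V)
    (hV : lambdaVar lam g ≤ ENNReal.ofReal V) (hg : Function.Periodic g (2 * Real.pi)) (x : ℝ)
    {e : ℝ} (he : e = 1 ∨ e = -1) {n : ℕ} (hn : 1 ≤ n) {u : ℝ} (hu : u ∈ Ioc 0 (Real.pi / n))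
    {N : ℕ} {τ : Fin N → ℕ} (hτ : Function.Injective τ) (hτn : ∀ i, 1 ≤ τ i ∧ τ i < n) :
    ∑ i, |g (x + e * (u + τ i * (Real.pi / n))) -
      g (x + e * (u + (τ i - 1 : ℕ) * (Real.pi / n)))| / lam ((i : ℕ) + 1) ≤ 2 * V := by
  have hπ := Real.pi_pos
  have hn0 : (0 : ℝ) < n := by exact_mod_cast hn
  set h := Real.pi / n with hh
  have hh0 : 0 < h := by positivity
  have hnh : n * h = Real.pi := by rw [hh]; field_simp
  have hcast : ∀ i, ((τ i - 1 : ℕ) : ℝ) = τ i - 1 := fun i => by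
    rw [Nat.cast_sub (hτn i).1, Nat.cast_one]
  have hup : ∀ i, (τ i : ℝ) * h ≤ Real.pi - h := fun i => by
    have : (τ i : ℝ) + 1 ≤ n := by exact_mod_cast (hτn i).2
    nlinarith
  have hlo : ∀ i, 0 ≤ ((τ i : ℝ) - 1) * h := fun i => by
    have : (1 : ℝ) ≤ τ i := by exact_mod_cast (hτn i).1
    exact mul_nonneg (by linarith) hh0.le
  have hsep : ∀ i j, τ i < τ j → (τ i : ℝ) * h ≤ ((τ j : ℝ) - 1) * h := fun i j hij => by
    have : (τ i : ℝ) + 1 ≤ τ j := by exact_mod_cast hij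
    exact mul_le_mul_of_nonneg_right (by linarith) hh0.le
  have hu1 := hu.1
  have hu2 := hu.2
  simp only [hcast]
  rcases he with rfl | rfl
  · refine sum_abs_div_le_of_window hpos hV0 hV hg x
      (a := fun i => x + 1 * (u + ((τ i : ℝ) - 1) * h)) (b := fun i => x + 1 * (u + τ i * h)) ?_ ?_
    · intro i
      have := hup i
      have := hlo i
      exact ⟨by linarith, by linarith, by linarith⟩
    · intro i j hij
      rcases lt_or_gt_of_ne (fun h => hij (hτ h)) with h' | h'
      · left; have := hsep i j h'; linarith
      · right; have := hsep j i h'; linarith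
  -- Reflection reverses each interval, so its endpoints exchange roles.
  · simp only [fun i => abs_sub_comm (g (x + -1 * (u + (τ i : ℝ) * h)))]
    refine sum_abs_div_le_of_window hpos hV0 hV hg (x - 2 * Real.pi)
      (b := fun i => x + -1 * (u + ((τ i : ℝ) - 1) * h)) (a := fun i => x + -1 * (u + τ i * h)) ?_ ?_
    · intro i
      have := hup i
      have := hlo i
      exact ⟨by linarith, by linarith, by linarith⟩
    · intro i j hij
      rcases lt_or_gt_of_ne (fun h => hij (hτ h)) with h' | h'
      · right; have := hsep i j h'; linarith
      · left; have := hsep j i h'; linarith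

variable {f : ℝ × ℝ → ℝ}

lemma lambdaVar_slice_fst_le (hper : Periodic2 f) (y : ℝ) :
    lambdaVar lam (fun x => f (x, y)) ≤ lambdaVar₁ lam f := by
  obtain ⟨z, hz, -⟩ := existsUnique_add_zsmul_mem_Ico Real.two_pi_pos y 0
  rw [zero_add] at hz
  have e : (fun x => f (x, y)) = fun x => f (x, y + z • (2 * Real.pi)) := by
    funext x
    have : Function.Periodic (fun y => f (x, y)) (2 * Real.pi) := fun y => hper.2 x y
    exact (this.zsmul z y).symm
  rw [e]
  exact le_iSup₂_of_le (f := fun y (_ : y ∈ Icc 0 (2 * Real.pi)) => lambdaVar lam fun x => f (x, y))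
    _ (Ico_subset_Icc_self hz) le_rfl

lemma lambdaVar_slice_snd_le (hper : Periodic2 f) (x : ℝ) :
    lambdaVar lam (fun y => f (x, y)) ≤ lambdaVar₂ lam f := by
  obtain ⟨z, hz, -⟩ := existsUnique_add_zsmul_mem_Ico Real.two_pi_pos x 0
  rw [zero_add] at hz
  have e : (fun y => f (x, y)) = fun y => f (x + z • (2 * Real.pi), y) := by
    funext y
    have : Function.Periodic (fun x => f (x, y)) (2 * Real.pi) := fun x => hper.1 x y
    exact (this.zsmul z x).symm
  rw [e]
  exact le_iSup₂_of_le (f := fun x (_ : x ∈ Icc 0 (2 * Real.pi)) => lambdaVar lam fun y => f (x, y))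
    _ (Ico_subset_Icc_self hz) le_rfl

lemma exists_lambdaVar_slice_le (hper : Periodic2 f) (hf : BoundedPartialVar lam f) :
    ∃ V : ℝ, 0 ≤ V ∧ (∀ y, lambdaVar lam (fun x => f (x, y)) ≤ ENNReal.ofReal V) ∧
      ∀ x, lambdaVar lam (fun y => f (x, y)) ≤ ENNReal.ofReal V := by
  refine ⟨(lambdaVar₁ lam f + lambdaVar₂ lam f).toReal, ENNReal.toReal_nonneg, ?_, ?_⟩
  · intro y
    rw [ENNReal.ofReal_toReal hf.ne]
    exact (lambdaVar_slice_fst_le hper y).trans le_self_add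
  · intro x
    rw [ENNReal.ofReal_toReal hf.ne]
    exact (lambdaVar_slice_snd_le hper x).trans le_add_self

/-- The local estimate: the sum over the grid points of one quadrant is small. -/
lemma exists_norm_sum_grid_le {α β : ℝ} (hα : α ∈ Ioo (0 : ℝ) 1) (hβ : β ∈ Ioo (0 : ℝ) 1)
    (hαβ : α + β < 1) (hpos : ∀ k, 1 ≤ k → 0 < lam k)
    (hanti : AntitoneOn (fun k : ℕ => lam k / (k : ℝ) ^ (1 - (α + β))) (Ici 1))
    (hsum : Summable fun k : ℕ => lam (k + 1) / ((k + 1 : ℕ) : ℝ) ^ (2 - (α + β)))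
    (hper : Periodic2 f) (hf : BoundedPartialVar lam f) {ε : ℝ} (hε : 0 < ε) :
    ∃ η > 0, ∃ P : ℕ, ∀ n m : ℕ, 1 ≤ n → 1 ≤ m → ∀ x y L e e' : ℝ,
      (e = 1 ∨ e = -1) → (e' = 1 ∨ e' = -1) →
      (∀ s ∈ Ioc 0 (P * (Real.pi / n)), ∀ t ∈ Ioc 0 (P * (Real.pi / m)),
        |f (x + e * s, y + e' * t) - L| ≤ η) →
      ∀ u ∈ Ioc 0 (Real.pi / n), ∀ v ∈ Ioc 0 (Real.pi / m),
      ‖∑ k ∈ Finset.range n, ∑ l ∈ Finset.range m,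
        ((f (x + e * (u + k * (Real.pi / n)), y + e' * (v + l * (Real.pi / m))) - L : ℝ) : ℂ) *
          (cesaroKernel α n (u + k * (Real.pi / n)) *
            cesaroKernel β m (v + l * (Real.pi / m)))‖ ≤ ε * (n * m) := by
  obtain ⟨V, hV0, hV1, hV2⟩ := exists_lambdaVar_slice_le hper hf
  obtain ⟨C, hC, hR⟩ := exists_norm_sum_cesaroKernel_le hα
  obtain ⟨C', hC', hR'⟩ := exists_norm_sum_cesaroKernel_le hβ
  -- Half of `ε` is for the variation, whose bound is `2 * V` because of the window lemma. The `+ 1`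
  -- covers `V = 0`. The other half goes to the block through the choice of `η`.
  have hε1 : 0 < ε / (C * C') / (2 * (2 * V + 1)) := by positivity
  obtain ⟨P, hP, hmain⟩ := exists_sum_abs_mixedDiff_le hα hβ hαβ hpos hsum hε1
  have hP0 : (0 : ℝ) < P := by exact_mod_cast hP
  refine ⟨ε / (C * C') / (2 * (4 * P ^ 2)), by positivity, P, ?_⟩
  intro n m hn hm x y L e e' he he' hclose u hu v hv
  have hn0 : (0 : ℝ) < n := by exact_mod_cast hn
  have hm0 : (0 : ℝ) < m := by exact_mod_cast hm
  have hπ := Real.pi_pos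
  set F : ℕ → ℕ → ℝ := fun k l =>
    f (x + e * (u + k * (Real.pi / n)), y + e' * (v + l * (Real.pi / m))) - L with hF
  have hgrid : ∀ {q : ℕ} {w : ℝ}, 1 ≤ q → w ∈ Ioc 0 (Real.pi / q) → ∀ k < P,
      w + k * (Real.pi / q) ∈ Ioc 0 (P * (Real.pi / q)) := by
    intro q w hq hw k hk
    have hq0 : (0 : ℝ) < q := by exact_mod_cast hq
    have hk' : (k : ℝ) + 1 ≤ P := by exact_mod_cast hk
    refine ⟨by have := hw.1; positivity, ?_⟩
    calc w + k * (Real.pi / q) ≤ (k + 1) * (Real.pi / q) := by linarith [hw.2]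
      _ ≤ P * (Real.pi / q) := by gcongr
  have hB := hmain F n m (2 * V) (ε / (C * C') / (2 * (4 * P ^ 2))) (by positivity) (by positivity)
    (fun l _ p hp => by
      refine sum_Ico_mul_rpow_le hα.1.le hα.2.le (by linarith [hβ.1]) hpos hanti
        (d := fun k => |F k l - F (k - 1) l|) (fun k => abs_nonneg _) ?_
      intro N τ hτ hτn
      simp only [hF, sub_sub_sub_cancel_right]
      exact sum_abs_div_le_of_grid hpos hV0 (hV1 _) (fun x => hper.1 x _) x he hn hu hτ
        fun i => ⟨hp.trans (hτn i).1, (hτn i).2⟩)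
    (fun k _ p hp => by
      refine sum_Ico_mul_rpow_le hβ.1.le hβ.2.le (by linarith [hα.1]) hpos hanti
        (d := fun l => |F k l - F k (l - 1)|) (fun k => abs_nonneg _) ?_
      intro N τ hτ hτn
      simp only [hF, sub_sub_sub_cancel_right]
      exact sum_abs_div_le_of_grid (g := fun y => f (_, y)) hpos hV0 (hV2 _)
        (fun y => hper.2 _ y) y he' hm hv hτ fun i => ⟨hp.trans (hτn i).1, (hτn i).2⟩)
    (fun k hk l hl => hclose _ (hgrid hn hu k hk) _ (hgrid hm hv l hl))
  rw [sum_sum_mul_eq_sum_sum_mixedDiff_mul F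
    (fun k => cesaroKernel α n (u + k * (Real.pi / n)))
    (fun l => cesaroKernel β m (v + l * (Real.pi / m)))]
  calc _ ≤ ∑ k ∈ Finset.range n, ∑ l ∈ Finset.range m, C * C' * (n * m) *
        (|mixedDiff F k l| * (((k : ℝ) + 1) ^ (α - 1) * ((l : ℝ) + 1) ^ (β - 1))) := by
        refine (norm_sum_le _ _).trans (Finset.sum_le_sum fun k hk =>
          (norm_sum_le _ _).trans (Finset.sum_le_sum fun l hl => ?_))
        rw [norm_mul, norm_mul, Complex.norm_real, Real.norm_eq_abs]
        have h1 := hR n hn u hu k (Finset.mem_range.1 hk)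
        have h2 := hR' m hm v hv l (Finset.mem_range.1 hl)
        calc _ ≤ |mixedDiff F k l| * ((C * n * ((k : ℝ) + 1) ^ (α - 1)) *
              (C' * m * ((l : ℝ) + 1) ^ (β - 1))) := by gcongr
          _ = _ := by ring
    _ = C * C' * (n * m) * ∑ k ∈ Finset.range n, ∑ l ∈ Finset.range m,
        (|mixedDiff F k l| * (((k : ℝ) + 1) ^ (α - 1) * ((l : ℝ) + 1) ^ (β - 1))) := by
        simp only [Finset.mul_sum]
    _ ≤ C * C' * (n * m) * (4 * P ^ 2 * (ε / (C * C') / (2 * (4 * P ^ 2))) +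
          2 * V * (ε / (C * C') / (2 * (2 * V + 1)))) := by gcongr
    _ ≤ C * C' * (n * m) * (ε / (C * C')) := by
        refine mul_le_mul_of_nonneg_left ?_ (by positivity)
        have hX : 0 < ε / (C * C') := by positivity
        have e1 : 4 * (P : ℝ) ^ 2 * (ε / (C * C') / (2 * (4 * P ^ 2))) = ε / (C * C') / 2 := by
          field_simp
        have e2 : 2 * V * (ε / (C * C') / (2 * (2 * V + 1))) ≤ ε / (C * C') / 2 := by
          rw [mul_div_assoc', div_le_iff₀ (by positivity)]
          nlinarith
        linarith
    _ = ε * (n * m) := by field_simp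

end

section

/-! ### Integration over the torus -/

/-- The lattice of periods. -/
noncomputable def periodLattice : AddSubgroup (ℝ × ℝ) :=
  (AddSubgroup.zmultiples (2 * Real.pi)).prod (AddSubgroup.zmultiples (2 * Real.pi))

instance : Countable periodLattice := by
  refine Set.Countable.mono (s₂ := (AddSubgroup.zmultiples (2 * Real.pi) : Set ℝ) ×ˢ
    (AddSubgroup.zmultiples (2 * Real.pi) : Set ℝ)) ?_ ?_
  · intro p hp; exact hp
  · have : (AddSubgroup.zmultiples (2 * Real.pi) : Set ℝ).Countable := by
      rw [AddSubgroup.coe_zmultiples]; exact countable_range _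
    exact this.prod this

lemma isAddFundamentalDomain_prod_Ioc (x y : ℝ) :
    IsAddFundamentalDomain periodLattice
      (Ioc x (x + 2 * Real.pi) ×ˢ Ioc y (y + 2 * Real.pi)) (volume : Measure (ℝ × ℝ)) := by
  refine IsAddFundamentalDomain.mk' (measurableSet_Ioc.prod measurableSet_Ioc).nullMeasurableSet ?_
  rintro ⟨p, q⟩
  obtain ⟨i, hi, hi'⟩ := existsUnique_add_zsmul_mem_Ioc Real.two_pi_pos p x
  obtain ⟨j, hj, hj'⟩ := existsUnique_add_zsmul_mem_Ioc Real.two_pi_pos q y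
  refine ⟨⟨(i • (2 * Real.pi), j • (2 * Real.pi)), ⟨i, rfl⟩, ⟨j, rfl⟩⟩, ?_, ?_⟩
  · refine ⟨?_, ?_⟩
    · simpa [AddSubgroup.vadd_def, add_comm] using hi
    · simpa [AddSubgroup.vadd_def, add_comm] using hj
  · rintro ⟨⟨s, t⟩, hst⟩ ⟨h1, h2⟩
    obtain ⟨⟨i', hi''⟩, j', hj''⟩ := id hst
    obtain rfl : i' • (2 * Real.pi) = s := hi''
    obtain rfl : j' • (2 * Real.pi) = t := hj''
    have e1 := hi' i' (by simpa [AddSubgroup.vadd_def, add_comm] using h1)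
    have e2 := hj' j' (by simpa [AddSubgroup.vadd_def, add_comm] using h2)
    subst e1 e2
    rfl

/-- The square, up to a null set, and the translated box are fundamental domains of the same
lattice. This allows centring the integral at the point under study. -/
lemma integral_square_eq_box {G : ℝ × ℝ → ℂ} (h1 : ∀ x y, G (x + 2 * Real.pi, y) = G (x, y))
    (h2 : ∀ x y, G (x, y + 2 * Real.pi) = G (x, y)) (hG : IntegrableOn G square) (x y : ℝ) :
    IntegrableOn G (Ioc x (x + 2 * Real.pi) ×ˢ Ioc y (y + 2 * Real.pi)) ∧
      ∫ p in square, G p = ∫ p in Ioc x (x + 2 * Real.pi) ×ˢ Ioc y (y + 2 * Real.pi), G p := by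
  have hae : (Ioc 0 (0 + 2 * Real.pi) ×ˢ Ioc 0 (0 + 2 * Real.pi) : Set (ℝ × ℝ)) =ᵐ[volume] square := by
    rw [zero_add, square, Measure.volume_eq_prod]
    exact Measure.set_prod_ae_eq Ioc_ae_eq_Icc Ioc_ae_eq_Icc
  have hinv : ∀ (g : periodLattice) (p : ℝ × ℝ), G (g +ᵥ p) = G p := by
    rintro ⟨⟨s, t⟩, hst⟩ ⟨p, q⟩
    obtain ⟨⟨i, hi⟩, j, hj⟩ := id hst
    obtain rfl : i • (2 * Real.pi) = s := hi
    obtain rfl : j • (2 * Real.pi) = t := hj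
    have e1 : Function.Periodic (fun p => G (p, q + j • (2 * Real.pi))) (2 * Real.pi) :=
      fun p => h1 p _
    have e2 : Function.Periodic (fun q => G (p, q)) (2 * Real.pi) := fun q => h2 p q
    have := (e1.zsmul i p).trans (e2.zsmul j q)
    simpa [AddSubgroup.vadd_def, add_comm] using this
  have hd := isAddFundamentalDomain_prod_Ioc 0 0
  have hd' := isAddFundamentalDomain_prod_Ioc x y
  refine ⟨(hd.integrableOn_iff hd' hinv).1 (hG.congr_set_ae hae), ?_⟩
  rw [← hd.setIntegral_eq hd' hinv]
  exact setIntegral_congr_set hae.symm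

/-! ### Decomposition into cells -/

/-- Serves twice: to fold a box centred at a point into four quadrants by reflections, and to cut
`(0, π]²` into translates of one cell. -/
lemma integral_prod_sum_map {I J : Type*} [Fintype I] [Fintype J] {S : I → ℝ → ℝ} {T : J → ℝ → ℝ}
    (hS : ∀ i, Measurable (S i)) (hT : ∀ j, Measurable (T j)) {μ μ₀ ν ν₀ : Measure ℝ}
    [SFinite μ₀] [SFinite ν₀]
    (hμ : μ = Measure.sum fun i => μ₀.map (S i)) (hν : ν = Measure.sum fun j => ν₀.map (T j))
    {G : ℝ × ℝ → ℂ} (hG : Integrable G (μ.prod ν)) :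
    (∀ i j, Integrable (fun p => G (S i p.1, T j p.2)) (μ₀.prod ν₀)) ∧
      ∫ p, G p ∂(μ.prod ν) = ∑ i, ∑ j, ∫ p, G (S i p.1, T j p.2) ∂(μ₀.prod ν₀) := by
  have e : μ.prod ν = ∑ q : I × J, (μ₀.prod ν₀).map (Prod.map (S q.1) (T q.2)) := by
    rw [hμ, hν, Measure.prod_sum, Measure.sum_fintype]
    exact Finset.sum_congr rfl fun q _ => Measure.map_prod_map _ _ (hS _) (hT _)
  rw [e] at hG ⊢
  have hG' := integrable_finsetSum_measure.1 hG
  refine ⟨fun i j => (hG' (i, j) (Finset.mem_univ _)).comp_measurable ((hS i).prodMap (hT j)), ?_⟩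
  rw [integral_finsetSum_measure hG', Fintype.sum_prod_type]
  refine Finset.sum_congr rfl fun i _ => Finset.sum_congr rfl fun j _ => ?_
  exact integral_map ((hS i).prodMap (hT j)).aemeasurable
    (hG' (i, j) (Finset.mem_univ _)).aestronglyMeasurable

lemma map_add_restrict_Ioc (c h : ℝ) :
    (volume.restrict (Ioc 0 h)).map (fun u => u + c) = volume.restrict (Ioc c (c + h)) := by
  have h1 := (measurePreserving_add_right volume c).restrict_preimage
    (measurableSet_Ioc (a := c) (b := c + h))
  have e : (fun u : ℝ => u + c) ⁻¹' Ioc c (c + h) = Ioc 0 h := by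
    ext u; simp [add_comm c]
  rw [e] at h1
  exact h1.map_eq

lemma restrict_Ioc_eq_sum {h : ℝ} (hh : 0 ≤ h) (n : ℕ) :
    volume.restrict (Ioc 0 (n * h)) =
      ∑ k ∈ Finset.range n, (volume.restrict (Ioc 0 h)).map fun u => u + k * h := by
  induction n with
  | zero => simp
  | succ n ih =>
    rw [Finset.sum_range_succ, ← ih, map_add_restrict_Ioc,
      ← Measure.restrict_union (Ioc_disjoint_Ioc_of_le le_rfl) measurableSet_Ioc,
      Ioc_union_Ioc_eq_Ioc (by positivity) (by linarith)]
    push_cast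
    ring_nf

lemma restrict_Ioc_zero_pi_eq_sum {n : ℕ} (hn : 1 ≤ n) :
    volume.restrict (Ioc 0 Real.pi) = Measure.sum fun k : Fin n =>
      (volume.restrict (Ioc 0 (Real.pi / n))).map fun u => u + (k : ℕ) * (Real.pi / n) := by
  have hn0 : (0 : ℝ) < n := by exact_mod_cast hn
  rw [Measure.sum_fintype, Fin.sum_univ_eq_sum_range (fun k : ℕ =>
    (volume.restrict (Ioc 0 (Real.pi / n))).map fun u => u + k * (Real.pi / n)) n,
    ← restrict_Ioc_eq_sum (div_nonneg Real.pi_pos.le hn0.le)]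
  congr 2
  field_simp

/-- The sign attached to a side of a point. -/
def sideSign (b : Bool) : ℝ := if b then 1 else -1

lemma restrict_Ioc_symm_eq_sum (x : ℝ) :
    volume.restrict (Ioc (x - Real.pi) (x + Real.pi)) = Measure.sum fun b : Bool =>
      (volume.restrict (Ioc 0 Real.pi)).map fun s => x + sideSign b * s := by
  have hπ := Real.pi_pos
  have e1 : (volume.restrict (Ioc 0 Real.pi)).map (fun s => x + sideSign true * s) =
      volume.restrict (Ioc x (x + Real.pi)) := by
    rw [← map_add_restrict_Ioc]; simp [sideSign, add_comm]
  have e2 : (volume.restrict (Ioc 0 Real.pi)).map (fun s => x + sideSign false * s) =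
      volume.restrict (Ioc (x - Real.pi) x) := by
    have h1 := (Measure.measurePreserving_sub_left (volume : Measure ℝ) x).restrict_preimage
      (measurableSet_Ioc (a := x - Real.pi) (b := x))
    have e : (fun u : ℝ => x - u) ⁻¹' Ioc (x - Real.pi) x = Ico 0 Real.pi := by
      ext u; simp [and_comm]
    rw [e, Measure.restrict_congr_set Ico_ae_eq_Ioc] at h1
    simpa [sideSign, sub_eq_add_neg] using h1.map_eq
  rw [Measure.sum_fintype, Fintype.sum_bool, e1, e2, add_comm (volume.restrict _),
    ← Measure.restrict_union (Ioc_disjoint_Ioc_of_le le_rfl) measurableSet_Ioc,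
    Ioc_union_Ioc_eq_Ioc (by linarith) (by linarith)]

/-! ### The Cesàro means as convolutions -/

lemma cesaroKernel_neg (a : ℝ) (n : ℕ) (s : ℝ) : cesaroKernel a n (-s) = cesaroKernel a n s := by
  unfold cesaroKernel
  congr 1
  refine Finset.sum_congr rfl fun i _ => ?_
  congr 1
  refine Finset.sum_equiv (Equiv.neg ℤ) (fun k => ?_) fun k _ => ?_
  · simp only [Finset.mem_Icc, Equiv.neg_apply]; omega
  · simp

lemma cesaroKernel_add_two_pi (a : ℝ) (n : ℕ) (s : ℝ) :
    cesaroKernel a n (s + 2 * Real.pi) = cesaroKernel a n s := by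
  unfold cesaroKernel
  congr 1
  refine Finset.sum_congr rfl fun i _ => ?_
  congr 1
  refine Finset.sum_congr rfl fun k _ => ?_
  rw [Complex.exp_eq_exp_iff_exists_int]
  exact ⟨k, by push_cast; ring⟩

lemma continuous_cesaroKernel (a : ℝ) (n : ℕ) : Continuous (cesaroKernel a n) := by
  unfold cesaroKernel
  fun_prop

lemma integral_exp_I_mul (k : ℤ) :
    ∫ s in (-Real.pi)..Real.pi, Complex.exp (Complex.I * k * s) =
      if k = 0 then 2 * (Real.pi : ℂ) else 0 := by
  split_ifs with hk
  · subst hk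
    simp
    ring
  · have hc : Complex.I * (k : ℂ) ≠ 0 := mul_ne_zero Complex.I_ne_zero (by exact_mod_cast hk)
    rw [integral_exp_mul_complex hc]
    have : Complex.exp (Complex.I * k * (Real.pi : ℝ)) =
        Complex.exp (Complex.I * k * ((-Real.pi : ℝ) : ℂ)) := by
      rw [Complex.exp_eq_exp_iff_exists_int]
      exact ⟨k, by push_cast; ring⟩
    rw [this, sub_self, zero_div]

/-- Over a full period only the frequency `0` survives. Its coefficients of order `-a - 1` sum to
the normalizing number of order `-a`, and evenness halves `2π`. -/
lemma integral_cesaroKernel {a : ℝ} (ha : a ∈ Ioo (0 : ℝ) 1) (n : ℕ) :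
    ∫ s in Ioc 0 Real.pi, cesaroKernel a n s = Real.pi := by
  have hπ := Real.pi_pos
  have hB : (cesaroNumber (-a) n : ℂ) ≠ 0 := by exact_mod_cast (cesaroNumber_neg_pos ha n).ne'
  have hfull : ∫ s in (-Real.pi)..Real.pi, cesaroKernel a n s = 2 * Real.pi := by
    unfold cesaroKernel
    rw [intervalIntegral.integral_const_mul, intervalIntegral.integral_finsetSum]
    · have : ∀ i ∈ Finset.range (n + 1), ∫ s in (-Real.pi)..Real.pi,
          (cesaroNumber (-a - 1) (n - i) : ℂ) *
            ∑ k ∈ Finset.Icc (-(i : ℤ)) i, Complex.exp (Complex.I * k * s) =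
          (cesaroNumber (-a - 1) (n - i) : ℂ) * (2 * Real.pi) := by
        intro i _
        rw [intervalIntegral.integral_const_mul, intervalIntegral.integral_finsetSum]
        · simp only [integral_exp_I_mul]
          rw [Finset.sum_ite_eq' , if_pos (by simp)]
        · intro k _
          exact Continuous.intervalIntegrable (by fun_prop) _ _
      rw [Finset.sum_congr rfl this, ← Finset.sum_mul]
      have hs : ∑ i ∈ Finset.range (n + 1), (cesaroNumber (-a - 1) (n - i) : ℂ) =
          cesaroNumber (-a) n := by
        rw [← sum_cesaroNumber_sub_one, ← Finset.sum_range_reflect]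
        push_cast
        exact Finset.sum_congr rfl fun i hi => by
          rw [Nat.sub_sub_self (by simpa [Nat.lt_succ_iff] using hi)]
      rw [hs]
      field_simp
    · intro i _
      exact Continuous.intervalIntegrable (by fun_prop) _ _
  have hi : ∀ c d : ℝ, IntervalIntegrable (cesaroKernel a n) volume c d :=
    fun c d => (continuous_cesaroKernel a n).intervalIntegrable _ _
  rw [← intervalIntegral.integral_add_adjacent_intervals (hi (-Real.pi) 0) (hi 0 Real.pi)] at hfull
  have hneg : ∫ s in (-Real.pi)..0, cesaroKernel a n s = ∫ s in 0..Real.pi, cesaroKernel a n s := by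
    have := intervalIntegral.integral_comp_neg (a := 0) (b := Real.pi) (cesaroKernel a n)
    simp only [cesaroKernel_neg, neg_zero] at this
    exact this.symm
  rw [hneg, ← two_mul] at hfull
  rw [← intervalIntegral.integral_of_le hπ.le]
  exact mul_left_cancel₀ two_ne_zero hfull

variable {f : ℝ × ℝ → ℝ}

lemma isCompact_square : IsCompact square := isCompact_Icc.prod isCompact_Icc

lemma integrableOn_square_mul (hint : IntegrableOn f square) {φ : ℝ × ℝ → ℂ} (hφ : Continuous φ) :
    IntegrableOn (fun p => (f p : ℂ) * φ p) square :=
  IntegrableOn.mul_continuousOn (Integrable.ofReal hint) hφ.continuousOn isCompact_square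

lemma partialSum_eq (hint : IntegrableOn f square) (M N : ℕ) (x y : ℝ) :
    partialSum f M N (x, y) = 1 / (4 * (Real.pi : ℂ) ^ 2) * ∫ p in square, (f p : ℂ) *
      ((∑ k ∈ Finset.Icc (-(M : ℤ)) M, Complex.exp (Complex.I * k * (x - p.1 : ℝ))) *
        ∑ l ∈ Finset.Icc (-(N : ℤ)) N, Complex.exp (Complex.I * l * (y - p.2 : ℝ))) := by
  simp only [Finset.sum_mul_sum]
  simp only [Finset.mul_sum]
  rw [integral_finsetSum _ fun k _ => integrable_finsetSum _ fun l _ =>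
    integrableOn_square_mul hint (by fun_prop), Finset.mul_sum]
  refine Finset.sum_congr rfl fun k _ => ?_
  rw [integral_finsetSum _ fun l _ => integrableOn_square_mul hint (by fun_prop), Finset.mul_sum]
  refine Finset.sum_congr rfl fun l _ => ?_
  rw [coeff, mul_assoc, mul_assoc]
  congr 1
  rw [← integral_mul_const]
  refine integral_congr_ae (Eventually.of_forall fun p => ?_)
  dsimp only
  rw [mul_assoc, mul_assoc, ← Complex.exp_add, ← Complex.exp_add, ← Complex.exp_add,
    ← Complex.exp_add]
  congr 2
  push_cast
  ring

lemma cesaroMean_eq (hint : IntegrableOn f square) (α β : ℝ) (n m : ℕ) (x y : ℝ) :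
    cesaroMean (-α) (-β) f n m (x, y) = 1 / (4 * (Real.pi : ℂ) ^ 2) *
      ∫ p in square, (f p : ℂ) * (cesaroKernel α n (x - p.1) * cesaroKernel β m (y - p.2)) := by
  have e : ∀ p : ℝ × ℝ, (f p : ℂ) * (cesaroKernel α n (x - p.1) * cesaroKernel β m (y - p.2)) =
      1 / (cesaroNumber (-α) n : ℂ) * (1 / (cesaroNumber (-β) m : ℂ)) *
      ∑ i ∈ Finset.range (n + 1), ∑ j ∈ Finset.range (m + 1),
        (cesaroNumber (-α - 1) (n - i) : ℂ) * (cesaroNumber (-β - 1) (m - j) : ℂ) * ((f p : ℂ) *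
      ((∑ k ∈ Finset.Icc (-(i : ℤ)) i, Complex.exp (Complex.I * k * (x - p.1 : ℝ))) *
        ∑ l ∈ Finset.Icc (-(j : ℤ)) j, Complex.exp (Complex.I * l * (y - p.2 : ℝ)))) := by
    intro p
    unfold cesaroKernel
    rw [mul_mul_mul_comm, Finset.sum_mul_sum, mul_left_comm]
    congr 1
    rw [Finset.mul_sum]
    refine Finset.sum_congr rfl fun i _ => ?_
    rw [Finset.mul_sum]
    exact Finset.sum_congr rfl fun j _ => by ring
  simp only [e]
  rw [cesaroMean, integral_const_mul, mul_left_comm]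
  congr 1
  rw [integral_finsetSum _ fun i _ => integrable_finsetSum _ fun j _ =>
    (integrableOn_square_mul hint (by fun_prop)).const_mul _, Finset.mul_sum]
  refine Finset.sum_congr rfl fun i _ => ?_
  rw [integral_finsetSum _ fun j _ => (integrableOn_square_mul hint (by fun_prop)).const_mul _,
    Finset.mul_sum]
  refine Finset.sum_congr rfl fun j _ => ?_
  rw [integral_const_mul, partialSum_eq hint]
  ring

end

/-! ### Convergence of the means -/

variable {f : ℝ × ℝ → ℝ} {lam : ℕ → ℝ} {α β : ℝ}

lemma sideSign_eq (b : Bool) : sideSign b = 1 ∨ sideSign b = -1 := by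
  cases b <;> simp [sideSign]

lemma abs_sideSign_mul (b : Bool) (s : ℝ) : |sideSign b * s| = |s| := by
  cases b <;> simp [sideSign]

lemma cesaroKernel_sub_sideSign (a : ℝ) (n : ℕ) (x s : ℝ) (b : Bool) :
    cesaroKernel a n (x - (x + sideSign b * s)) = cesaroKernel a n s := by
  rw [show x - (x + sideSign b * s) = -(sideSign b * s) by ring, cesaroKernel_neg]
  cases b <;> simp [sideSign, cesaroKernel_neg]

/-- The deviation of the Cesàro mean from a mean of four numbers, as a sum over quadrants. -/
lemma cesaroMean_sub_eq (hα : α ∈ Ioo (0 : ℝ) 1) (hβ : β ∈ Ioo (0 : ℝ) 1) (hper : Periodic2 f)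
    (hint : IntegrableOn f square) (n m : ℕ) (x y : ℝ) (L : Bool → Bool → ℝ) :
    (∀ b b', Integrable (fun p : ℝ × ℝ =>
      ((f (x + sideSign b * p.1, y + sideSign b' * p.2) - L b b' : ℝ) : ℂ) *
        (cesaroKernel α n p.1 * cesaroKernel β m p.2))
      ((volume.restrict (Ioc 0 Real.pi)).prod (volume.restrict (Ioc 0 Real.pi)))) ∧
    cesaroMean (-α) (-β) f n m (x, y) - (((∑ b, ∑ b', L b b') / 4 : ℝ) : ℂ) =
      1 / (4 * (Real.pi : ℂ) ^ 2) * ∑ b, ∑ b', ∫ p : ℝ × ℝ,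
        ((f (x + sideSign b * p.1, y + sideSign b' * p.2) - L b b' : ℝ) : ℂ) *
          (cesaroKernel α n p.1 * cesaroKernel β m p.2)
        ∂((volume.restrict (Ioc 0 Real.pi)).prod (volume.restrict (Ioc 0 Real.pi))) := by
  set ρ : Measure ℝ := volume.restrict (Ioc 0 Real.pi) with hρ
  set G : ℝ × ℝ → ℂ := fun p =>
    (f p : ℂ) * (cesaroKernel α n (x - p.1) * cesaroKernel β m (y - p.2)) with hG
  have hcα := continuous_cesaroKernel α n
  have hcβ := continuous_cesaroKernel β m
  have hper' : ∀ (a : ℝ) (q : ℕ) (c s : ℝ), cesaroKernel a q (c - (s + 2 * Real.pi)) =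
      cesaroKernel a q (c - s) := fun a q c s => by
    rw [← cesaroKernel_add_two_pi a q (c - (s + 2 * Real.pi))]; congr 1; ring
  obtain ⟨hbox, hbox'⟩ := integral_square_eq_box (G := G)
    (fun s t => by simp only [hG, hper.1, hper'])
    (fun s t => by simp only [hG, hper.2, hper'])
    (integrableOn_square_mul hint (by fun_prop)) (x - Real.pi) (y - Real.pi)
  have e : ∀ c : ℝ, c - Real.pi + 2 * Real.pi = c + Real.pi := fun c => by ring
  rw [e, e, IntegrableOn, Measure.volume_eq_prod, ← Measure.prod_restrict] at hbox
  rw [e, e, Measure.volume_eq_prod, ← Measure.prod_restrict] at hbox'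
  obtain ⟨hi, hs⟩ := integral_prod_sum_map (S := fun b s => x + sideSign b * s)
    (T := fun b s => y + sideSign b * s) (fun b => by fun_prop) (fun b => by fun_prop)
    (restrict_Ioc_symm_eq_sum x) (restrict_Ioc_symm_eq_sum y) hbox
  simp only [hG, cesaroKernel_sub_sideSign] at hi hs
  have hκ : Integrable (fun p : ℝ × ℝ => cesaroKernel α n p.1 * cesaroKernel β m p.2)
      (ρ.prod ρ) := by
    refine Integrable.mul_prod ?_ ?_
    · exact (hcα.integrableOn_Icc (a := 0) (b := Real.pi)).mono_set Ioc_subset_Icc_self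
    · exact (hcβ.integrableOn_Icc (a := 0) (b := Real.pi)).mono_set Ioc_subset_Icc_self
  have hsub : ∀ (b b' : Bool) (p : ℝ × ℝ),
      ((f (x + sideSign b * p.1, y + sideSign b' * p.2) - L b b' : ℝ) : ℂ) *
        (cesaroKernel α n p.1 * cesaroKernel β m p.2) =
      (f (x + sideSign b * p.1, y + sideSign b' * p.2) : ℂ) *
        (cesaroKernel α n p.1 * cesaroKernel β m p.2) -
      (L b b' : ℂ) * (cesaroKernel α n p.1 * cesaroKernel β m p.2) := fun b b' p => by
    push_cast; ring
  simp only [hsub]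
  refine ⟨fun b b' => (hi b b').sub (hκ.const_mul _), ?_⟩
  have hπ : (Real.pi : ℂ) ≠ 0 := by exact_mod_cast Real.pi_ne_zero
  -- By the normalization each constant `L b b'` integrates to `L b b' * π²`, which matches the
  -- average of the four after division by `4π²`.
  simp only [fun b b' => integral_sub (hi b b') (hκ.const_mul (L b b' : ℂ)), integral_const_mul,
    integral_prod_mul, hρ, integral_cesaroKernel hα, integral_cesaroKernel hβ,
    Finset.sum_sub_distrib]
  rw [cesaroMean_eq hint, mul_sub]
  refine congrArg₂ (· - ·) (congrArg _ (hbox'.trans hs)) ?_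
  simp only [← Finset.sum_mul]
  push_cast
  field_simp

/-- The grid estimate `ε * n * m`, integrated over a cell of area `π² / (n m)`, gives `ε * π²` per
quadrant. Since `η` and `P` precede `n`, `m` and the point, the same estimate serves pointwise and
uniform convergence. -/
lemma exists_norm_cesaroMean_sub_le (hα : α ∈ Ioo (0 : ℝ) 1) (hβ : β ∈ Ioo (0 : ℝ) 1)
    (hαβ : α + β < 1) (hpos : ∀ k, 1 ≤ k → 0 < lam k)
    (hanti : AntitoneOn (fun k : ℕ => lam k / (k : ℝ) ^ (1 - (α + β))) (Ici 1))
    (hsum : Summable fun k : ℕ => lam (k + 1) / ((k + 1 : ℕ) : ℝ) ^ (2 - (α + β)))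
    (hper : Periodic2 f) (hint : IntegrableOn f square) (hf : BoundedPartialVar lam f)
    {ε : ℝ} (hε : 0 < ε) :
    ∃ η > 0, ∃ P : ℕ, ∀ n m : ℕ, 1 ≤ n → 1 ≤ m → ∀ (x y : ℝ) (L : Bool → Bool → ℝ),
      (∀ b b', ∀ s ∈ Ioc 0 (P * (Real.pi / n)), ∀ t ∈ Ioc 0 (P * (Real.pi / m)),
        |f (x + sideSign b * s, y + sideSign b' * t) - L b b'| ≤ η) →
      ‖cesaroMean (-α) (-β) f n m (x, y) - (((∑ b, ∑ b', L b b') / 4 : ℝ) : ℂ)‖ ≤ ε := by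
  obtain ⟨η, hη, P, hmain⟩ := exists_norm_sum_grid_le hα hβ hαβ hpos hanti hsum hper hf hε
  refine ⟨η, hη, P, fun n m hn hm x y L hL => ?_⟩
  obtain ⟨hi, he⟩ := cesaroMean_sub_eq hα hβ hper hint n m x y L
  have hπ := Real.pi_pos
  have hn0 : (0 : ℝ) < n := by exact_mod_cast hn
  have hm0 : (0 : ℝ) < m := by exact_mod_cast hm
  have hq : ∀ b b' : Bool, ‖∫ p : ℝ × ℝ,
        ((f (x + sideSign b * p.1, y + sideSign b' * p.2) - L b b' : ℝ) : ℂ) *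
          (cesaroKernel α n p.1 * cesaroKernel β m p.2)
        ∂((volume.restrict (Ioc 0 Real.pi)).prod (volume.restrict (Ioc 0 Real.pi)))‖ ≤
      ε * Real.pi ^ 2 := by
    intro b b'
    obtain ⟨hi', hs'⟩ := integral_prod_sum_map
      (S := fun (k : Fin n) u => u + (k : ℕ) * (Real.pi / n))
      (T := fun (l : Fin m) v => v + (l : ℕ) * (Real.pi / m))
      (fun k => by fun_prop) (fun l => by fun_prop)
      (restrict_Ioc_zero_pi_eq_sum hn) (restrict_Ioc_zero_pi_eq_sum hm) (hi b b')
    rw [hs']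
    have hsum' : ∀ k : Fin n, Integrable (fun p : ℝ × ℝ => ∑ l : Fin m,
        ((f (x + sideSign b * (p.1 + (k : ℕ) * (Real.pi / n)),
          y + sideSign b' * (p.2 + (l : ℕ) * (Real.pi / m))) - L b b' : ℝ) : ℂ) *
          (cesaroKernel α n (p.1 + (k : ℕ) * (Real.pi / n)) *
            cesaroKernel β m (p.2 + (l : ℕ) * (Real.pi / m))))
        ((volume.restrict (Ioc 0 (Real.pi / n))).prod (volume.restrict (Ioc 0 (Real.pi / m)))) :=
      fun k => integrable_finsetSum _ fun l _ => hi' k l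
    simp only [← integral_finsetSum _ fun l _ => hi' _ l]
    rw [← integral_finsetSum _ fun k _ => hsum' k]
    refine (norm_integral_le_of_norm_le_const (C := ε * (n * m)) ?_).trans (le_of_eq ?_)
    · rw [Measure.prod_restrict]
      filter_upwards [ae_restrict_mem (measurableSet_Ioc.prod measurableSet_Ioc)] with p hp
      have := hmain n m hn hm x y (L b b') (sideSign b) (sideSign b') (sideSign_eq b)
        (sideSign_eq b') (hL b b') p.1 hp.1 p.2 hp.2
      simp only [Finset.sum_range] at this
      exact this
    · rw [Measure.prod_restrict, measureReal_restrict_apply_univ, measureReal_prod_prod,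
        Real.volume_real_Ioc_of_le (by positivity), Real.volume_real_Ioc_of_le (by positivity)]
      field_simp
      ring
  rw [he, norm_mul]
  have hc : ‖1 / (4 * (Real.pi : ℂ) ^ 2)‖ = 1 / (4 * Real.pi ^ 2) := by
    rw [norm_div, norm_one, norm_mul, norm_pow, Complex.norm_real, Real.norm_eq_abs,
      abs_of_pos hπ, Complex.norm_ofNat]
  rw [hc]
  calc _ ≤ 1 / (4 * Real.pi ^ 2) * ∑ b : Bool, ∑ b' : Bool, ε * Real.pi ^ 2 := by
        refine mul_le_mul_of_nonneg_left ?_ (by positivity)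
        exact (norm_sum_le _ _).trans (Finset.sum_le_sum fun b _ =>
          (norm_sum_le _ _).trans (Finset.sum_le_sum fun b' _ => hq b b'))
    _ = ε := by simp; field_simp; norm_num

/-! ### Passage to the limit -/

lemma eventually_Ioc_subset (P : ℕ) {W : Set ℝ} (hW : W ∈ 𝓝[>] (0 : ℝ)) :
    ∀ᶠ n : ℕ in atTop, Ioc 0 (P * (Real.pi / n)) ⊆ W := by
  obtain ⟨δ, hδ, hsub⟩ := mem_nhdsGT_iff_exists_Ioo_subset.1 hW
  have ht : Tendsto (fun n : ℕ => P * (Real.pi / n)) atTop (𝓝 0) := by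
    simpa using (tendsto_const_div_atTop_nhds_zero_nat Real.pi).const_mul (P : ℝ)
  filter_upwards [ht.eventually (gt_mem_nhds hδ)] with n hn
  exact fun s hs => hsub ⟨hs.1, hs.2.trans_lt hn⟩

lemma tendsto_add_sideSign_true (x : ℝ) :
    Tendsto (fun s => x + sideSign true * s) (𝓝[>] 0) (𝓝[>] x) := by
  refine tendsto_nhdsWithin_iff.2 ⟨?_, ?_⟩
  · have : Continuous fun s => x + sideSign true * s := by fun_prop
    simpa using (this.tendsto 0).mono_left nhdsWithin_le_nhds
  · filter_upwards [self_mem_nhdsWithin] with s hs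
    have : (0 : ℝ) < s := hs
    simpa [sideSign] using this

lemma tendsto_add_sideSign_false (x : ℝ) :
    Tendsto (fun s => x + sideSign false * s) (𝓝[>] 0) (𝓝[<] x) := by
  refine tendsto_nhdsWithin_iff.2 ⟨?_, ?_⟩
  · have : Continuous fun s => x + sideSign false * s := by fun_prop
    simpa using (this.tendsto 0).mono_left nhdsWithin_le_nhds
  · filter_upwards [self_mem_nhdsWithin] with s hs
    have : (0 : ℝ) < s := hs
    simpa [sideSign] using this

lemma eventually_forall_abs_sub_le {L η : ℝ} {b b' : Bool} {x y : ℝ} (hη : 0 < η) (P : ℕ)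
    (h : Tendsto (fun p : ℝ × ℝ => f (x + sideSign b * p.1, y + sideSign b' * p.2))
      (𝓝[>] 0 ×ˢ 𝓝[>] 0) (𝓝 L)) :
    ∀ᶠ k : ℕ × ℕ in atTop ×ˢ atTop, ∀ s ∈ Ioc 0 (P * (Real.pi / k.1)),
      ∀ t ∈ Ioc 0 (P * (Real.pi / k.2)),
        |f (x + sideSign b * s, y + sideSign b' * t) - L| ≤ η := by
  obtain ⟨W, hW, W', hW', hsub⟩ := mem_prod_iff.1 (h (Metric.closedBall_mem_nhds L hη))
  filter_upwards [(eventually_Ioc_subset P hW).prod_mk (eventually_Ioc_subset P hW')]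
    with k hk s hs t ht
  exact hsub (mk_mem_prod (hk.1 hs) (hk.2 ht))

end PartialVariation

open PartialVariation in
theorem theorem1 (α β : ℝ) (hα : α ∈ Ioo (0 : ℝ) 1) (hβ : β ∈ Ioo (0 : ℝ) 1)
    (hαβ : α + β < 1)
    (lam : ℕ → ℝ) (hpos : ∀ k, 1 ≤ k → 0 < lam k)
    (hanti : AntitoneOn (fun k : ℕ => lam k / (k : ℝ) ^ (1 - (α + β))) (Ici 1))
    (hlim : Tendsto (fun k : ℕ => lam k / (k : ℝ) ^ (1 - (α + β))) atTop (𝓝 0))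
    (hsum : Summable fun k : ℕ => lam (k + 1) / ((k + 1 : ℕ) : ℝ) ^ (2 - (α + β)))
    (f : ℝ × ℝ → ℝ) (hper : PartialVariation.Periodic2 f)
    (hint : IntegrableOn f PartialVariation.square)
    (hf : PartialVariation.BoundedPartialVar lam f) :
    (∀ x y Lpp Lpm Lmp Lmm : ℝ,
      Tendsto f (𝓝[>] x ×ˢ 𝓝[>] y) (𝓝 Lpp) →
      Tendsto f (𝓝[>] x ×ˢ 𝓝[<] y) (𝓝 Lpm) →
      Tendsto f (𝓝[<] x ×ˢ 𝓝[>] y) (𝓝 Lmp) →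
      Tendsto f (𝓝[<] x ×ˢ 𝓝[<] y) (𝓝 Lmm) →
      PartialVariation.CesaroSummable (-α) (-β) f (x, y) ((Lpp + Lpm + Lmp + Lmm) / 4)) ∧
    (∀ K : Set (ℝ × ℝ), IsCompact K → (∀ p ∈ K, ContinuousAt f p) →
      PartialVariation.CesaroSummableUniformlyOn (-α) (-β) f K) := by
  have hlarge : ∀ᶠ k : ℕ × ℕ in atTop ×ˢ atTop, 1 ≤ k.1 ∧ 1 ≤ k.2 :=
    (eventually_ge_atTop 1).prod_mk (eventually_ge_atTop 1)
  refine ⟨fun x y Lpp Lpm Lmp Lmm hpp hpm hmp hmm => ?_, fun K hK hcont => ?_⟩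
  · refine Metric.tendsto_nhds.2 fun ε hε => ?_
    obtain ⟨η, hη, P, hmain⟩ := exists_norm_cesaroMean_sub_le hα hβ hαβ hpos hanti hsum hper hint
      hf (half_pos hε)
    have ht := tendsto_add_sideSign_true
    have hf' := tendsto_add_sideSign_false
    filter_upwards [hlarge,
      eventually_forall_abs_sub_le (b := true) (b' := true) hη P
        (hpp.comp ((ht x).prodMap (ht y))),
      eventually_forall_abs_sub_le (b := true) (b' := false) hη P
        (hpm.comp ((ht x).prodMap (hf' y))),
      eventually_forall_abs_sub_le (b := false) (b' := true) hη P
        (hmp.comp ((hf' x).prodMap (ht y))),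
      eventually_forall_abs_sub_le (b := false) (b' := false) hη P
        (hmm.comp ((hf' x).prodMap (hf' y)))] with k hk h1 h2 h3 h4
    have := hmain k.1 k.2 hk.1 hk.2 x y
      (fun b b' => if b then (if b' then Lpp else Lpm) else (if b' then Lmp else Lmm))
      (by
        intro b b'
        cases b <;> cases b'
        · exact h4
        · exact h3
        · exact h2
        · exact h1)
    rw [dist_eq_norm]
    refine lt_of_le_of_lt ?_ (half_lt_self hε)
    simpa [← add_assoc] using this
  · refine Metric.tendstoUniformlyOn_iff.2 fun ε hε => ?_
    obtain ⟨η, hη, P, hmain⟩ := exists_norm_cesaroMean_sub_le hα hβ hαβ hpos hanti hsum hper hint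
      hf (half_pos hε)
    -- Compactness gives one `δ` for all `p ∈ K`, with the nearby point allowed to lie outside `K`;
    -- the grid points need not belong to `K`.
    obtain ⟨δ, hδ, hunif⟩ := Metric.mem_uniformity_dist.1
      (hK.uniformContinuousAt_of_continuousAt f hcont (Metric.dist_mem_uniformity hη))
    have hW : Ioo 0 δ ∈ 𝓝[>] (0 : ℝ) := Ioo_mem_nhdsGT hδ
    filter_upwards [hlarge, (eventually_Ioc_subset P hW).prod_mk (eventually_Ioc_subset P hW)]
      with k hk hsub p hp
    have := hmain k.1 k.2 hk.1 hk.2 p.1 p.2 (fun _ _ => f p) (by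
      intro b b' s hs t ht
      have hs' := hsub.1 hs
      have ht' := hsub.2 ht
      have hd : dist p (p.1 + sideSign b * s, p.2 + sideSign b' * t) < δ := by
        rw [dist_comm, Prod.dist_eq, Real.dist_eq, Real.dist_eq, add_sub_cancel_left,
          add_sub_cancel_left, abs_sideSign_mul, abs_sideSign_mul, abs_of_pos hs'.1,
          abs_of_pos ht'.1]
        exact max_lt hs'.2 ht'.2
      have := hunif hd hp
      rw [abs_sub_comm]
      exact le_of_lt this)
    rw [dist_comm, dist_eq_norm]
    refine lt_of_le_of_lt ?_ (half_lt_self hε)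
    have e : (∑ _b : Bool, ∑ _b' : Bool, f p) / 4 = f p := by simp; ring
    rwa [e] at this
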